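/- Let $K$ be a field, $0\le s\le n$ integers, and $S=K[x_1,\dots,x_n]$ with the standard grading. All modules are finitely generated $\mathbb Z$-graded $S$-modules. For a nonzero Cohen–Macaulay module $N$ of codimension $s$ (that is, $\dim N=n-s$), let $\beta_{i,j}$ be its graded Betti numbers: the $i$-th module of the minimal graded free resolution of $N$ is $\bigoplus_j S(-j)^{\beta_{i,j}}$. Put $\beta_0=\sum_j\beta_{0,j}$. The Hilbert coefficients $e_0(N),\dots,e_{n-s}(N)\in\mathbb Z$ are the unique integers with $$\sum_{j\le x}\dim_K N_j=\sum_{i=0}^{n-s}(-1)^i e_i(N)\binom{x+n-s-i}{n-s-i}\qquad\text{for all } x\gg 0 .$$ For strictly increasing sequences of integers $m=(m_0,\dots,m_s)$ and $M=(M_0,\dots,M_s)$, let $V_{m,M}$ be the $\mathbb Q$-vector space of all matrices $(\beta_{i,j})$ with rational entries such that $\beta_{i,j}=0$ unless $0\le i\le s$ and $m_i\le j\le M_i$, and $\sum_{i,j}(-1)^i j^k\beta_{i,j}=0$ for $0\le k\le s-1$. Let $B_{m,M}$ be the set of Betti diagrams of Cohen–Macaulay $S$-modules of codimension $s$ that lie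 in $V_{m,M}$, and let $\bar B_{m,M}=\{(\beta_{i,j}/\beta_0) : (\beta_{i,j})\in B_{m,M}\}$. For a strictly increasing integer sequence $d=(d_0,\dots,d_s)$, the pure diagram $\pi(d)$ is the matrix with $\pi(d)_{i,j}=0$ for $j\ne d_i$, $\pi(d)_{0,d_0}=1$, and $$\pi(d)_{i,d_i}=(-1)^{i+1}\prod_{k\neq 0,\,k\ne i}\frac{d_k-d_0}{d_k-d_i}\qquad(1\le i\le s).$$ Let $\Pi_{m,M}$ be the set of pure diagrams lying in $V_{m,M}$. For integers $d_1,\dots,d_s$ and $i\ge 0$ put $$h_i(d_1,\dots,d_s)=\sum_{1\le j_1\le\cdots\le j_i\le s}\ \prod_{k=1}^{i}\bigl(d_{j_k}-(j_k+k-1)\bigr).$$ **Proposition.** Suppose that the Boij–Söderberg conjecture holds for modules of codimension $s$ over $S$: for all strictly increasing integer sequences $m=(m_0,\dots,m_s)$ and $M=(M_0,\dots,M_s)$, the set $\bar B_{m,M}$ is the convex hull over $\mathbb Q$ of $\Pi_{m,M}$. Then for every Cohen–Macaulay $S$-module $N$ of codimension $s$ that is generated in degree $0$, with minimal and maximal shifts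 $m_i=\min\{j:\beta_{i,j}\neq0\}$ and $M_i=\max\{j:\beta_{i,j}\ne0\}$ for $i=1,\dots,s$, the Hilbert coefficients are well defined and $$\beta_0\,\frac{m_1m_2\cdots m_s}{(s+i)!}\,h_i(m_1,\dots,m_s)\ \le\ e_i(N)\ \le\ \beta_0\,\frac{M_1M_2\cdots M_s}{(s+i)!}\,h_i(M_1,\dots,M_s)\qquad(i=0,1,\dots,n-s).$$ -/

import Mathlib

open MvPolynomial

noncomputable section

namespace BettiHilbert

universe u

/-! ### Graded modules over the standard graded polynomial ring -/

/-- A `ℤ`-grading `N = ⨁ N_j` of a module over `K[x_1, …, x_n]`, where every variable has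
degree one. -/
structure Grading (K : Type u) [Field K] (n : ℕ) (N : Type u) [AddCommGroup N] [Module K N]
    [Module (MvPolynomial (Fin n) K) N] where
  /-- The graded component of degree `j`. -/
  piece : ℤ → Submodule K N
  isInternal : DirectSum.IsInternal piece
  smul_mem : ∀ (e : ℕ) (p : MvPolynomial (Fin n) K) (j : ℤ) (x : N),
    p.IsHomogeneous e → x ∈ piece j → p • x ∈ piece (j + e)

/-- The polynomial `p` is homogeneous of the (integer) degree `e`, i.e. all monomials occurring in
`p` have degree `e`. For negative `e` this says `p = 0`. -/
def IsHomogeneousInt {K : Type u} [Field K] {n : ℕ} (p : MvPolynomial (Fin n) K) (e : ℤ) : Prop :=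
  ∀ t ∈ p.support, ((Finsupp.degree t : ℕ) : ℤ) = e

/-- The module is generated by its elements of degree zero. -/
def Grading.GeneratedInDegreeZero {K : Type u} [Field K] {n : ℕ} {N : Type u} [AddCommGroup N]
    [Module K N] [Module (MvPolynomial (Fin n) K) N] (𝒩 : Grading K n N) : Prop :=
  Submodule.span (MvPolynomial (Fin n) K) (𝒩.piece 0 : Set N) = ⊤

/-- The (finitely generated, graded) module `N` over `S = K[x_1, …, x_n]` is Cohen-Macaulay: its
depth equals its dimension, i.e. the graded maximal ideal contains an `N`-regular sequence whose
length is `dim N`. The zero module is excluded, as `N / (r) N ≠ 0` is part of regularity. -/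
def IsCohenMacaulay (K : Type u) [Field K] (n : ℕ) (N : Type u) [AddCommGroup N]
    [Module (MvPolynomial (Fin n) K) N] : Prop :=
  ∃ r : List (MvPolynomial (Fin n) K),
    (∀ f ∈ r, f ∈ RingHom.ker (constantCoeff : MvPolynomial (Fin n) K →+* K)) ∧
    RingTheory.Sequence.IsRegular N r ∧
    Module.supportDim (MvPolynomial (Fin n) K) N = (r.length : WithBot ℕ∞)

/-- The module `N` has codimension `s`, i.e. `dim N = n - s`. -/
def HasCodim (K : Type u) [Field K] (n : ℕ) (N : Type u) [AddCommGroup N]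
    [Module (MvPolynomial (Fin n) K) N] (s : ℕ) : Prop :=
  Module.supportDim (MvPolynomial (Fin n) K) N + (s : WithBot ℕ∞) = (n : WithBot ℕ∞)

/-! ### Minimal graded free resolutions and Betti diagrams -/

/-- A minimal graded free resolution `⋯ → F_1 → F_0 → N → 0` with
`F_i = ⨁_a S(-shift i a)`, `a = 1, …, rank i`. The basis elements are homogeneous of degree
`shift i a`, all maps have degree zero, and minimality says that the entries of the matrices of
the differentials lie in the graded maximal ideal. -/
structure MinimalResolution {K : Type u} [Field K] {n : ℕ} {N : Type u} [AddCommGroup N]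
    [Module K N] [Module (MvPolynomial (Fin n) K) N] (𝒩 : Grading K n N) where
  rank : ℕ → ℕ
  shift : (i : ℕ) → Fin (rank i) → ℤ
  aug : (Fin (rank 0) → MvPolynomial (Fin n) K) →ₗ[MvPolynomial (Fin n) K] N
  diff : (i : ℕ) → (Fin (rank (i + 1)) → MvPolynomial (Fin n) K) →ₗ[MvPolynomial (Fin n) K]
    (Fin (rank i) → MvPolynomial (Fin n) K)
  aug_degree : ∀ a, aug (Pi.single a 1) ∈ 𝒩.piece (shift 0 a)
  diff_degree : ∀ i a b,
    IsHomogeneousInt (diff i (Pi.single a 1) b) (shift (i + 1) a - shift i b)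
  aug_surjective : Function.Surjective aug
  exact_aug : Function.Exact (diff 0) aug
  exact_diff : ∀ i, Function.Exact (diff (i + 1)) (diff i)
  minimal : ∀ i a b, constantCoeff (diff i (Pi.single a 1) b) = 0

/-- The Betti diagram `(β_{i,j})`: `β_{i,j}` is the number of summands `S(-j)` of `F_i`. -/
def MinimalResolution.diagram {K : Type u} [Field K] {n : ℕ} {N : Type u} [AddCommGroup N]
    [Module K N] [Module (MvPolynomial (Fin n) K) N] {𝒩 : Grading K n N}
    (F : MinimalResolution 𝒩) : ℕ → ℤ → ℚ :=
  fun i j => ((Finset.univ.filter fun a => F.shift i a = j).card : ℚ)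

/-- `β_0 = ∑_j β_{0,j}`. -/
def betaZero (β : ℕ → ℤ → ℚ) : ℚ := ∑ᶠ j, β 0 j

/-- The minimal shift `m_i = min {j | β_{i,j} ≠ 0}`. -/
def minShift (β : ℕ → ℤ → ℚ) (i : ℕ) : ℤ := sInf {j | β i j ≠ 0}

/-- The maximal shift `M_i = max {j | β_{i,j} ≠ 0}`. -/
def maxShift (β : ℕ → ℤ → ℚ) (i : ℕ) : ℤ := sSup {j | β i j ≠ 0}

/-! ### The Boij-Söderberg conjecture -/

/-- The rational vector space `V_{m,M}` of all matrices `(β_{i,j})` with `β_{i,j} = 0` unless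
`0 ≤ i ≤ s` and `m_i ≤ j ≤ M_i`, and `∑_{i,j} (-1)^i j^k β_{i,j} = 0` for `k = 0, …, s - 1`.
(By the first condition it suffices to sum over `m_i ≤ j ≤ M_i`.) -/
def diagramSpace {s : ℕ} (m M : Fin (s + 1) → ℤ) : Submodule ℚ (ℕ → ℤ → ℚ) where
  carrier := {β |
    (∀ i : ℕ, s < i → ∀ j, β i j = 0) ∧
    (∀ (i : Fin (s + 1)) (j : ℤ), j < m i ∨ M i < j → β i j = 0) ∧
    ∀ k < s, ∑ i : Fin (s + 1), ∑ j ∈ Finset.Icc (m i) (M i),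
      (-1 : ℚ) ^ (i : ℕ) * (j : ℚ) ^ k * β i j = 0}
  zero_mem' := by simp
  add_mem' := by
    rintro β γ ⟨h1, h2, h3⟩ ⟨g1, g2, g3⟩
    refine ⟨fun i hi j => ?_, fun i j hj => ?_, fun k hk => ?_⟩
    · simp [h1 i hi j, g1 i hi j]
    · simp [h2 i j hj, g2 i j hj]
    · simp [mul_add, Finset.sum_add_distrib, h3 k hk, g3 k hk]
  smul_mem' := by
    rintro c β ⟨h1, h2, h3⟩
    refine ⟨fun i hi j => ?_, fun i j hj => ?_, fun k hk => ?_⟩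
    · simp [h1 i hi j]
    · simp [h2 i j hj]
    · have := congrArg (c * ·) (h3 k hk)
      simpa [Finset.mul_sum, mul_left_comm] using this

/-- `B_{m,M}`: the Betti diagrams in `V_{m,M}` of finitely generated graded Cohen-Macaulay
modules of codimension `s` over `K[x_1, …, x_n]`. -/
def bettiDiagrams (K : Type u) [Field K] (n : ℕ) {s : ℕ} (m M : Fin (s + 1) → ℤ) :
    Set (ℕ → ℤ → ℚ) :=
  {β | β ∈ diagramSpace m M ∧
    ∃ (N : Type u) (_ : AddCommGroup N) (_ : Module K N) (_ : Module (MvPolynomial (Fin n) K) N)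
      (_ : IsScalarTower K (MvPolynomial (Fin n) K) N) (𝒩 : Grading K n N)
      (F : MinimalResolution 𝒩),
      Module.Finite (MvPolynomial (Fin n) K) N ∧ IsCohenMacaulay K n N ∧ HasCodim K n N s ∧
        F.diagram = β}

/-- The set of normalized Betti diagrams `(β_{i,j} / β_0)`, `β ∈ B_{m,M}`. -/
def normalizedBettiDiagrams (K : Type u) [Field K] (n : ℕ) {s : ℕ} (m M : Fin (s + 1) → ℤ) :
    Set (ℕ → ℤ → ℚ) :=
  (fun β i j => β i j / betaZero β) '' bettiDiagrams K n m M

/-- The pure diagram `π(d)`: for `0 ≤ i ≤ s` the only nonzero entry of row `i` is in position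
`j = d_i`. It is `1` for `i = 0` and
`(-1)^(i+1) ∏_{k ≠ 0, i} (d_k - d_0) / (d_k - d_i)` for `i ≥ 1`. -/
def pureDiagram {s : ℕ} (d : Fin (s + 1) → ℤ) : ℕ → ℤ → ℚ := fun i j =>
  if h : i < s + 1 then
    if j = d ⟨i, h⟩ then
      if i = 0 then 1
      else (-1) ^ (i + 1) * ∏ k ∈ Finset.univ.filter (fun k : Fin (s + 1) => k ≠ ⟨i, h⟩ ∧ k ≠ 0),
        ((d k : ℚ) - d 0) / ((d k : ℚ) - d ⟨i, h⟩)
    else 0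
  else 0

/-- `Π_{m,M}`: the pure diagrams in `V_{m,M}`. -/
def pureDiagrams {s : ℕ} (m M : Fin (s + 1) → ℤ) : Set (ℕ → ℤ → ℚ) :=
  {π | ∃ d : Fin (s + 1) → ℤ, StrictMono d ∧ pureDiagram d = π ∧ π ∈ diagramSpace m M}

/-- The Boij-Söderberg conjecture for modules of codimension `s` over `K[x_1, …, x_n]`. -/
def BoijSoderbergConjecture (K : Type u) [Field K] (n s : ℕ) : Prop :=
  ∀ m M : Fin (s + 1) → ℤ, StrictMono m → StrictMono M →
    normalizedBettiDiagrams K n m M = convexHull ℚ (pureDiagrams m M)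

/-! ### Hilbert coefficients and the conjectured bounds -/

/-- `H(N, x) = ∑_{j ≤ x} dim_K N_j`. -/
def Grading.hilbertFunction {K : Type u} [Field K] {n : ℕ} {N : Type u} [AddCommGroup N]
    [Module K N] [Module (MvPolynomial (Fin n) K) N] (𝒩 : Grading K n N) (x : ℤ) : ℕ :=
  ∑ᶠ (j : ℤ) (_ : j ≤ x), Module.finrank K (𝒩.piece j)

/-- The integers `e_0, …, e_d` are the Hilbert coefficients of the `d`-dimensional module `N`:
`H(N, x) = ∑_{i=0}^d (-1)^i e_i binom(x + d - i, d - i)` for all `x ≫ 0`. -/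
def Grading.IsHilbertCoefficients {K : Type u} [Field K] {n : ℕ} {N : Type u} [AddCommGroup N]
    [Module K N] [Module (MvPolynomial (Fin n) K) N] (𝒩 : Grading K n N) {d : ℕ}
    (e : Fin (d + 1) → ℤ) : Prop :=
  ∀ᶠ x : ℕ in Filter.atTop, (𝒩.hilbertFunction x : ℤ) =
    ∑ i : Fin (d + 1), (-1) ^ (i : ℕ) * e i * ((x + (d - (i : ℕ))).choose (d - (i : ℕ)) : ℤ)

/-- `h_i(d_1, …, d_s) = ∑_{1 ≤ j_1 ≤ ⋯ ≤ j_i ≤ s} ∏_{k=1}^i (d_{j_k} - (j_k + k - 1))`.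
The indices `j` and `k` start at zero in the code, so `d j` is `d_{j+1}`, and `j_k + k - 1`
becomes `(j k + 1) + (k + 1) - 1 = j k + 1 + k`. -/
def hPoly {s : ℕ} (i : ℕ) (d : Fin s → ℤ) : ℤ :=
  open Classical in
  ∑ j ∈ Finset.univ.filter (fun j : Fin i → Fin s => Monotone j),
    ∏ k : Fin i, (d (j k) - ((j k : ℕ) + 1 + (k : ℕ)))

/-- `β_0 * (d_1 ⋯ d_s) / (s + i)! * h_i(d_1, …, d_s)`. -/
def bound {s : ℕ} (b : ℚ) (i : ℕ) (d : Fin s → ℤ) : ℚ :=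
  b * ((∏ j, (d j : ℚ)) / ((s + i).factorial : ℚ)) * (hPoly i d : ℚ)

/-- The conjectured bounds for the Hilbert coefficients of modules of codimension `s` over
`K[x_1, …, x_n]`. The first clause of the conclusion says that the Hilbert coefficients `e_i(N)`,
`i = 0, …, n - s`, are well defined. -/
def HilbertCoefficientConjecture (K : Type u) [Field K] (n s : ℕ) : Prop :=
  ∀ (N : Type u) [AddCommGroup N] [Module K N] [Module (MvPolynomial (Fin n) K) N]
    [IsScalarTower K (MvPolynomial (Fin n) K) N] (𝒩 : Grading K n N) (F : MinimalResolution 𝒩),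
    Module.Finite (MvPolynomial (Fin n) K) N → IsCohenMacaulay K n N → HasCodim K n N s →
    𝒩.GeneratedInDegreeZero →
    (∃! e : Fin (n - s + 1) → ℤ, 𝒩.IsHilbertCoefficients e) ∧
    ∀ e : Fin (n - s + 1) → ℤ, 𝒩.IsHilbertCoefficients e → ∀ i : Fin (n - s + 1),
      bound (betaZero F.diagram) i (fun j : Fin s => minShift F.diagram ((j : ℕ) + 1)) ≤ (e i : ℚ) ∧
      (e i : ℚ) ≤ bound (betaZero F.diagram) i (fun j : Fin s => maxShift F.diagram ((j : ℕ) + 1))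

end BettiHilbert

end

noncomputable section

namespace BettiHilbert

/-! ### Divided differences of products of linear factors -/

/-! The Hilbert coefficients are linear functionals of the Betti diagram. In degrees at most x the
minimal resolution is an exact sequence of finite-dimensional spaces, so the Hilbert function is,
for large x, the alternating sum of binom(x - c + n, n) over all shifts c. Vandermonde expands it in
the polynomials binom(x + n - k, n - k) with coefficients (-1)^k A_k, where A_k is the alternating
sum of binom(c, k) (`MinimalResolution.altSum`). Because dim N = n - s, the function is
o(x^(n-s+1)), which forces A_k = 0 for k < s. Hence e_i = (-1)^s A_{s+i}
(`MinimalResolution.isHilbertCoefficients`), and the same vanishing gives the equations that put the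
diagram into V_{m,M}.

On a pure diagram with d_0 = 0 this functional is a divided difference of (t-1)(t-2)⋯(t-s-i+1) at
d_1, …, d_s, up to the factor d_1⋯d_s/(s+i)!. Such a divided difference is exactly h_i
(`sum_prod_sub_div_eq_shiftedComplete`, `sum_pureDiagram_mul_choose`), and the resulting expression
is monotone in d (`bound_mono`).

The Boij–Söderberg conjecture writes the diagram as β_0 times a convex combination of pure diagrams.
Their entries are nonnegative, so nothing cancels: every d of nonzero weight has d_0 = 0 and runs
between the minimal and the maximal shifts of N. Averaging the monotonicity inequalities gives both
bounds (`MinimalResolution.bound_le_altSum_le`).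

Two inputs from commutative algebra are needed: a Cohen–Macaulay module has projective dimension at
most its codimension (`MinimalResolution.rank_eq_zero`, by iterated mapping cones), and its Hilbert
function grows no faster than x^(n-s) (Noether normalization of S modulo the annihilator of N). -/

/-- The sum `∑_{j_0 ≤ ⋯ ≤ j_{i-1}} ∏_k (d_{j_k} - c_{j_k + k})`, the complete symmetric
polynomial of degree `i` in `d` shifted by the sequence `c`. -/
def shiftedComplete {s : ℕ} (i : ℕ) (d : Fin s → ℚ) (c : ℕ → ℚ) : ℚ :=
  open Classical in
  ∑ j ∈ Finset.univ.filter (fun j : Fin i → Fin s => Monotone j),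
    ∏ k : Fin i, (d (j k) - c ((j k : ℕ) + k))

lemma shiftedComplete_zero {s : ℕ} (d : Fin s → ℚ) (c : ℕ → ℚ) :
    shiftedComplete 0 d c = 1 := by
  classical
  unfold shiftedComplete
  rw [Finset.filter_true_of_mem]
  · simp
  · intro j _ a
    exact a.elim0

lemma shiftedComplete_empty (i : ℕ) (d : Fin 0 → ℚ) (c : ℕ → ℚ) :
    shiftedComplete (i + 1) d c = 0 := by
  classical
  unfold shiftedComplete
  apply Finset.sum_eq_zero
  intro j _
  exact (j 0).elim0

/-- Split the monotone sequences by whether they start at 0. Deleting a leading 0 lowers k by one,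
and avoiding 0 altogether lowers every j_k by one; either way the index j_k + k of c moves by one.
-/
lemma shiftedComplete_succ_succ {s : ℕ} (i : ℕ) (d : Fin (s + 1) → ℚ) (c : ℕ → ℚ) :
    shiftedComplete (i + 1) d c =
      (d 0 - c 0) * shiftedComplete i d (fun q => c (q + 1)) +
        shiftedComplete (i + 1) (fun l => d l.succ) (fun q => c (q + 1)) := by
  classical
  unfold shiftedComplete
  rw [← Finset.sum_filter_add_sum_filter_not _ (fun j : Fin (i + 1) → Fin (s + 1) => j 0 = 0)]
  congr 1
  · rw [Finset.mul_sum]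
    refine Finset.sum_nbij' (fun j => Fin.tail j) (fun j => Fin.cons 0 j) ?_ ?_ ?_ ?_ ?_
    · intro j hj
      simp only [Finset.mem_filter, Finset.mem_univ, true_and] at hj ⊢
      exact fun a b hab => hj.1 (Fin.succ_le_succ_iff.2 hab)
    · intro j hj
      simp only [Finset.mem_filter, Finset.mem_univ, true_and] at hj ⊢
      refine ⟨?_, by simp⟩
      intro a b hab
      induction a using Fin.cases with
      | zero => simp
      | succ a =>
        induction b using Fin.cases with
        | zero => simp at hab
        | succ b => simpa using hj (Fin.succ_le_succ_iff.1 hab)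
    · intro j hj
      simp only [Finset.mem_filter, Finset.mem_univ, true_and] at hj
      rw [← hj.2]
      exact Fin.cons_self_tail j
    · intro j _
      exact Fin.tail_cons _ _
    · intro j hj
      simp only [Finset.mem_filter, Finset.mem_univ, true_and] at hj
      rw [Fin.prod_univ_succ, hj.2]
      simp [Fin.tail, add_assoc]
  · refine (Finset.sum_bij (fun j _ k => (j k).succ) ?_ ?_ ?_ ?_).symm
    · intro j hj
      simp only [Finset.mem_filter, Finset.mem_univ, true_and] at hj ⊢
      exact ⟨fun a b hab => Fin.succ_le_succ_iff.2 (hj hab), Fin.succ_ne_zero _⟩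
    · intro j _ j' _ h
      funext k
      exact Fin.succ_injective _ (congrFun h k)
    · intro j hj
      simp only [Finset.mem_filter, Finset.mem_univ, true_and] at hj
      have hne : ∀ k, j k ≠ 0 := fun k hk =>
        hj.2 (Fin.le_zero_iff.1 (hk ▸ hj.1 (Fin.zero_le k)))
      refine ⟨fun k => (j k).pred (hne k), ?_, ?_⟩
      · simp only [Finset.mem_filter, Finset.mem_univ, true_and]
        exact fun a b hab => Fin.pred_le_pred_iff.2 (hj.1 hab)
      · funext k
        simp
    · intro j _
      simp [add_right_comm]

/-- The Leibniz rule for divided differences: write t - c_0 = (d_0 - c_0) + (t - d_0). The second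
summand kills the node d_0 and cancels the factor d_l - d_0 in the other denominators. -/
lemma sum_prod_sub_div_succ {s : ℕ} (m : ℕ) (d : Fin (s + 1) → ℚ)
    (hd : Function.Injective d) (c : ℕ → ℚ) :
    ∑ l, (∏ q ∈ Finset.range (m + 1), (d l - c q)) / ∏ k ∈ Finset.univ.erase l, (d l - d k) =
      (d 0 - c 0) * ∑ l, (∏ q ∈ Finset.range m, (d l - c (q + 1))) /
          ∏ k ∈ Finset.univ.erase l, (d l - d k) +
        ∑ l : Fin s, (∏ q ∈ Finset.range m, (d l.succ - c (q + 1))) /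
          ∏ k ∈ Finset.univ.erase l, (d l.succ - d k.succ) := by
  have h : ∀ l : Fin s, ∏ k ∈ Finset.univ.erase l.succ, (d l.succ - d k) =
      (d l.succ - d 0) * ∏ k ∈ Finset.univ.erase l, (d l.succ - d k.succ) := by
    intro l
    have : (Finset.univ.erase l.succ : Finset (Fin (s + 1))) =
        insert 0 ((Finset.univ.erase l).map (Fin.succEmb s)) := by
      ext k
      induction k using Fin.cases <;> simp [Fin.ext_iff]
    rw [this, Finset.prod_insert (by simp), Finset.prod_map]
    simp
  rw [Finset.mul_sum, Fin.sum_univ_succ, Fin.sum_univ_succ, add_assoc, ← Finset.sum_add_distrib]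
  congr 1
  · rw [Finset.prod_range_succ']
    ring
  · refine Finset.sum_congr rfl fun l _ => ?_
    have hne : d l.succ - d 0 ≠ 0 := sub_ne_zero.2 fun h => Fin.succ_ne_zero _ (hd h)
    have hne' : ∏ k ∈ Finset.univ.erase l, (d l.succ - d k.succ) ≠ 0 :=
      Finset.prod_ne_zero_iff.2 fun k hk => sub_ne_zero.2 fun h =>
        (Finset.ne_of_mem_erase hk) (Fin.succ_injective _ (hd h)).symm
    rw [Finset.prod_range_succ', h l]
    field_simp
    ring

/-- The divided difference of `∏_{q < m} (t - c_q)` at pairwise distinct points. -/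
lemma sum_prod_sub_div_eq_shiftedComplete {s : ℕ} (i : ℕ) (d : Fin (s + 1) → ℚ)
    (hd : Function.Injective d) (c : ℕ → ℚ) :
    ∑ l, (∏ q ∈ Finset.range (s + i), (d l - c q)) / ∏ k ∈ Finset.univ.erase l, (d l - d k) =
      shiftedComplete i d c := by
  induction i generalizing s c with
  | zero =>
    rw [shiftedComplete_zero]
    -- P is monic of degree s, and the divided difference at s + 1 nodes reads off its leading
    -- coefficient.
    let P : Polynomial ℚ := ∏ q ∈ Finset.range s, (Polynomial.X - Polynomial.C (c q))
    have hP : P.Monic := Polynomial.monic_prod_of_monic _ _ fun q _ => Polynomial.monic_X_sub_C _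
    have hdeg : P.natDegree = s := by
      rw [Polynomial.natDegree_prod_of_monic _ _ fun q _ => Polynomial.monic_X_sub_C _]
      simp
    have h := Lagrange.leadingCoeff_eq_sum (s := Finset.univ) (v := d) hd.injOn (P := P)
      (by rw [Polynomial.degree_eq_natDegree hP.ne_zero, hdeg]; simp)
    rw [hP.leadingCoeff] at h
    rw [h]
    simp [P, Polynomial.eval_prod]
  -- Both sides obey the same recursion. The outer induction lowers i with the nodes kept, the inner
  -- one drops the first node with i + 1 kept.
  | succ i ihi =>
    induction s generalizing c with
    | zero =>
      rw [← add_assoc, sum_prod_sub_div_succ _ d hd, ihi d hd, shiftedComplete_succ_succ,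
        shiftedComplete_empty]
      simp
    | succ s ihs =>
      rw [← add_assoc, sum_prod_sub_div_succ _ d hd, ihi d hd, shiftedComplete_succ_succ,
        ← ihs (fun l => d l.succ) (fun a b h => Fin.succ_injective _ (hd h))]
      simp [add_right_comm, add_assoc]

/-- The amount subtracted in h_i depends only on j_k + k, so it comes from the sequence c = 1, 2, 3,
…, the nonzero roots of binomial coefficients. -/
lemma hPoly_cast {s : ℕ} (i : ℕ) (d : Fin s → ℤ) :
    (hPoly i d : ℚ) = shiftedComplete i (fun j => (d j : ℚ)) (fun q => (q : ℚ) + 1) := by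
  unfold hPoly shiftedComplete
  push_cast
  refine Finset.sum_congr rfl fun j _ => Finset.prod_congr rfl fun k _ => ?_
  ring

/-! ### Pure diagrams and their Hilbert coefficients -/

lemma pureDiagram_apply {s : ℕ} (d : Fin (s + 1) → ℤ) (i : Fin (s + 1)) (j : ℤ) :
    pureDiagram d i j = if j = d i then pureDiagram d i (d i) else 0 := by
  have hi : (i : ℕ) < s + 1 := i.2
  unfold pureDiagram
  rw [dif_pos hi, dif_pos hi, if_pos rfl]

lemma pureDiagram_zero_self {s : ℕ} (d : Fin (s + 1) → ℤ) :
    pureDiagram d 0 (d 0) = 1 := by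
  simp [pureDiagram]

lemma pureDiagram_succ_self {s : ℕ} (d : Fin (s + 1) → ℤ) (l : Fin s) :
    pureDiagram d (l.succ : ℕ) (d l.succ) = (-1) ^ (l : ℕ) *
      ∏ k ∈ Finset.univ.erase l, ((d k.succ : ℚ) - d 0) / ((d k.succ : ℚ) - d l.succ) := by
  have h : (Finset.univ.filter fun k : Fin (s + 1) => k ≠ l.succ ∧ k ≠ 0) =
      (Finset.univ.erase l).map (Fin.succEmb s) := by
    ext k
    induction k using Fin.cases <;> simp
  unfold pureDiagram
  rw [dif_pos l.succ.2, if_pos rfl, if_neg (by simp)]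
  simp only [Fin.eta]
  rw [h, Finset.prod_map]
  simp [pow_succ]

lemma pureDiagram_self_pos {s : ℕ} (d : Fin (s + 1) → ℤ) (hd : StrictMono d) (i : Fin (s + 1)) :
    0 < pureDiagram d i (d i) := by
  induction i using Fin.cases with
  | zero => simp [pureDiagram_zero_self]
  | succ l =>
    rw [pureDiagram_succ_self]
    -- Exactly the l factors with k < l have a negative denominator, so the sign is shared out among
    -- them.
    have h1 : ((-1 : ℚ)) ^ (l : ℕ) = ∏ k ∈ Finset.univ.erase l, if k < l then (-1 : ℚ) else 1 := by
      rw [Finset.prod_ite, Finset.prod_const, Finset.prod_const_one, mul_one]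
      congr 1
      have : ((Finset.univ.erase l).filter fun k => k < l) = Finset.Iio l := by
        ext k
        simp only [Finset.mem_filter, Finset.mem_erase, Finset.mem_univ, and_true, Finset.mem_Iio]
        exact ⟨fun h => h.2, fun h => ⟨h.ne, h⟩⟩
      rw [this, Fin.card_Iio]
    rw [h1, ← Finset.prod_mul_distrib]
    refine Finset.prod_pos fun k hk => ?_
    have h0 : (0 : ℚ) < d k.succ - d 0 :=
      sub_pos.2 (by exact_mod_cast hd (Fin.succ_pos k))
    split_ifs with hkl
    · have : (d k.succ : ℚ) - d l.succ < 0 :=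
        sub_neg.2 (by exact_mod_cast hd (Fin.succ_lt_succ_iff.2 hkl))
      rw [neg_one_mul, ← div_neg]
      exact div_pos h0 (by linarith)
    · have hlk : l < k := lt_of_le_of_ne (not_lt.1 hkl) (Finset.ne_of_mem_erase hk).symm
      have : (0 : ℚ) < d k.succ - d l.succ :=
        sub_pos.2 (by exact_mod_cast hd (Fin.succ_lt_succ_iff.2 hlk))
      rw [one_mul]
      exact div_pos h0 this

lemma cast_ringChoose_eq_prod (a : ℤ) (k : ℕ) :
    ((Ring.choose a k : ℤ) : ℚ) = (∏ q ∈ Finset.range k, ((a : ℚ) - q)) / k.factorial := by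
  have h := Ring.descPochhammer_eq_factorial_smul_choose a k
  rw [eq_div_iff (by positivity)]
  have h2 : (descPochhammer ℤ k).smeval a = ∏ q ∈ Finset.range k, (a - q) := by
    rw [← descPochhammer_eval_eq_prod_range, Polynomial.eval_eq_smeval]
  rw [h2, nsmul_eq_mul] at h
  have := congrArg (Int.cast (R := ℚ)) h
  push_cast at this
  rw [this, mul_comm]

/-- The alternating sum `∑_l (-1)^l π(d)_l binom(d_l, s + i)` of a pure diagram with `d_0 = 0`. -/
lemma sum_pureDiagram_mul_choose {s : ℕ} (i : ℕ) (d : Fin (s + 1) → ℤ) (hd : StrictMono d)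
    (hd0 : d 0 = 0) :
    (-1) ^ s * ∑ l : Fin (s + 1), (-1 : ℚ) ^ (l : ℕ) * pureDiagram d l (d l) *
      (Ring.choose (d l) (s + i) : ℤ) = bound 1 i (fun j : Fin s => d j.succ) := by
  unfold bound
  rw [hPoly_cast, Fin.sum_univ_succ]
  rcases s with _ | s
  · rcases i with _ | i
    · simp [pureDiagram_zero_self, shiftedComplete_zero]
    · simp [hd0, shiftedComplete_empty, Ring.choose_zero_succ]
  · have hd0' : Ring.choose (d 0) (s + 1 + i) = 0 := by
      rw [hd0]
      exact Ring.choose_zero_pos ℤ (by omega)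
    have hinj : Function.Injective fun l : Fin (s + 1) => (d l.succ : ℚ) := fun a b h =>
      Fin.succ_injective _ (hd.injective (Int.cast_injective h))
    rw [hd0', ← sum_prod_sub_div_eq_shiftedComplete i _ hinj, one_mul, Finset.mul_sum]
    simp only [Int.cast_zero, mul_zero, zero_add]
    rw [Finset.mul_sum]
    refine Finset.sum_congr rfl fun l _ => ?_
    -- The numerator of the pure diagram is the product of the d_k with k ≠ l. The factor q = 0 of
    -- the binomial coefficient supplies the missing d_l; its other factors are those of the divided
    -- difference.
    rw [pureDiagram_succ_self, cast_ringChoose_eq_prod, hd0,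
      ← Finset.mul_prod_erase _ _ (Finset.mem_univ l),
      show s + 1 + i = s + i + 1 by omega, Finset.prod_range_succ', Finset.prod_div_distrib]
    have hne : ∏ k ∈ Finset.univ.erase l, ((d l.succ : ℚ) - d k.succ) ≠ 0 :=
      Finset.prod_ne_zero_iff.2 fun k hk => sub_ne_zero.2 fun h =>
        (Finset.ne_of_mem_erase hk) (hinj h).symm
    have hsign : ∏ k ∈ Finset.univ.erase l, ((d k.succ : ℚ) - d l.succ) =
        (-1) ^ s * ∏ k ∈ Finset.univ.erase l, ((d l.succ : ℚ) - d k.succ) := by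
      have : ((-1 : ℚ)) ^ s = ∏ k ∈ Finset.univ.erase l, (-1 : ℚ) := by
        simp [Finset.card_erase_of_mem]
      rw [this, ← Finset.prod_mul_distrib]
      exact Finset.prod_congr rfl fun k _ => by ring
    rw [hsign]
    have hs : ((-1 : ℚ)) ^ s ≠ 0 := by simp
    have hl : ((-1 : ℚ)) ^ (l : ℕ) * (-1) ^ (l : ℕ) = 1 := by
      rw [← mul_pow]; simp
    have hss : ((-1 : ℚ)) ^ s * (-1) ^ s = 1 := by
      rw [← mul_pow]; simp
    have hf : (((s + i + 1).factorial : ℕ) : ℚ) ≠ 0 := by positivity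
    push_cast
    simp only [sub_zero, Fin.val_succ, pow_succ]
    field_simp
    rw [sq, hl, one_mul]

/-! ### Monotonicity of the bounds -/

/-- The integers u_k - k start nonnegative and fall by at most one per step, so they cannot become
negative without passing through 0. -/
lemma pos_of_prod_sub_ne_zero {i : ℕ} (u : Fin i → ℤ) (hu : Monotone u) (h0 : ∀ k, 0 ≤ u k)
    (h : ∏ k : Fin i, (u k - (k : ℕ)) ≠ 0) (k : Fin i) : 0 < u k - (k : ℕ) := by
  rw [Finset.prod_ne_zero_iff] at h
  obtain ⟨k, hk⟩ := k
  induction k with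
  | zero =>
    have := h ⟨0, hk⟩ (Finset.mem_univ _)
    have := h0 ⟨0, hk⟩
    simp only [Nat.cast_zero] at *
    omega
  | succ k ih =>
    have h1 := h ⟨k + 1, hk⟩ (Finset.mem_univ _)
    have h2 := ih (by omega)
    have h3 := hu (show (⟨k, by omega⟩ : Fin i) ≤ ⟨k + 1, hk⟩ by simp)
    push_cast at *
    omega

lemma prod_sub_nonneg {i : ℕ} (u : Fin i → ℤ) (hu : Monotone u) (h0 : ∀ k, 0 ≤ u k) :
    0 ≤ ∏ k : Fin i, (u k - (k : ℕ)) := by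
  by_cases h : ∏ k : Fin i, (u k - (k : ℕ)) = 0
  · exact h.ge
  · exact Finset.prod_nonneg fun k _ => (pos_of_prod_sub_ne_zero u hu h0 h k).le

/-- Individual factors may be negative, so a factorwise comparison is not available in general. But
either the left product is 0 and the right one is nonnegative, or all factors on the left are
positive. -/
lemma prod_sub_le_prod_sub {i : ℕ} (u v : Fin i → ℤ) (hu : Monotone u) (hu0 : ∀ k, 0 ≤ u k)
    (hv : Monotone v) (huv : ∀ k, u k ≤ v k) :
    ∏ k : Fin i, (u k - (k : ℕ)) ≤ ∏ k : Fin i, (v k - (k : ℕ)) := by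
  by_cases h : ∏ k : Fin i, (u k - (k : ℕ)) = 0
  · rw [h]
    exact prod_sub_nonneg v hv fun k => (hu0 k).trans (huv k)
  · exact Finset.prod_le_prod (fun k _ => (pos_of_prod_sub_ne_zero u hu hu0 h k).le)
      fun k _ => by linarith [huv k]

/-- Composed with a monotone j, this turns each summand of h_i into a product of factors u_k - k
with u monotone, so that h_i can be compared summand by summand. -/
lemma monotone_sub_index {s : ℕ} (a : Fin s → ℤ) (ha : StrictMono a) :
    Monotone fun j => a j - ((j : ℕ) + 1) := by
  rcases s with _ | s
  · exact fun a => a.elim0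
  refine Fin.monotone_iff_le_succ.2 fun j => ?_
  have := ha (Fin.castSucc_lt_succ (i := j))
  simp only [Fin.val_castSucc, Fin.val_succ]
  push_cast
  omega

lemma hPoly_nonneg {s : ℕ} (i : ℕ) (a : Fin s → ℤ) (ha : StrictMono a)
    (ha0 : ∀ j : Fin s, ((j : ℕ) : ℤ) + 1 ≤ a j) : 0 ≤ hPoly i a := by
  refine Finset.sum_nonneg fun j hj => ?_
  have hj' : Monotone j := by simpa using hj
  have := prod_sub_nonneg (fun k => a (j k) - ((j k : ℕ) + 1))
    (fun x y hxy => monotone_sub_index a ha (hj' hxy)) (fun k => by linarith [ha0 (j k)])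
  simpa only [sub_sub] using this

lemma hPoly_mono {s : ℕ} (i : ℕ) (a b : Fin s → ℤ) (ha : StrictMono a) (hb : StrictMono b)
    (ha0 : ∀ j : Fin s, ((j : ℕ) : ℤ) + 1 ≤ a j) (hab : ∀ j, a j ≤ b j) : hPoly i a ≤ hPoly i b := by
  refine Finset.sum_le_sum fun j hj => ?_
  have hj' : Monotone j := by simpa using hj
  have := prod_sub_le_prod_sub (fun k => a (j k) - ((j k : ℕ) + 1))
    (fun k => b (j k) - ((j k : ℕ) + 1))
    (fun x y hxy => monotone_sub_index a ha (hj' hxy)) (fun k => by linarith [ha0 (j k)])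
    (fun x y hxy => monotone_sub_index b hb (hj' hxy)) (fun k => by linarith [hab (j k)])
  simpa only [sub_sub] using this

lemma bound_mono {s : ℕ} (c : ℚ) (hc : 0 ≤ c) (i : ℕ) (a b : Fin s → ℤ) (ha : StrictMono a)
    (hb : StrictMono b) (ha0 : ∀ j : Fin s, ((j : ℕ) : ℤ) + 1 ≤ a j) (hab : ∀ j, a j ≤ b j) :
    bound c i a ≤ bound c i b := by
  have hpos : ∀ j, (0 : ℚ) ≤ a j := fun j => by
    have := ha0 j
    exact_mod_cast (by omega : (0 : ℤ) ≤ a j)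
  have h1 : ∏ j, (a j : ℚ) ≤ ∏ j, (b j : ℚ) :=
    Finset.prod_le_prod (fun j _ => hpos j) fun j _ => by exact_mod_cast hab j
  have h0 : 0 ≤ ∏ j, (a j : ℚ) := Finset.prod_nonneg fun j _ => hpos j
  have h2 : (hPoly i a : ℚ) ≤ hPoly i b := by exact_mod_cast hPoly_mono i a b ha hb ha0 hab
  have h3 : (0 : ℚ) ≤ hPoly i a := by exact_mod_cast hPoly_nonneg i a ha ha0
  have h4 : (0 : ℚ) ≤ ∏ j, (b j : ℚ) := h0.trans h1
  unfold bound
  gcongr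

/-! ### Binomial expansions and growth of polynomials -/

section Binomials

open Filter Topology

lemma ringChoose_add_nat (x k : ℕ) :
    Ring.choose ((x : ℤ) + k) k = ((x + k).choose k : ℤ) := by
  rw [← Ring.choose_natCast (R := ℤ)]
  push_cast
  rfl

lemma ringChoose_neg_sub_one (r : ℤ) (k : ℕ) :
    Ring.choose (-r - 1) k = (-1) ^ k * Ring.choose (r + k) k := by
  rw [show -r - 1 = -(r + 1) by ring, Ring.choose_neg, show r + 1 + k - 1 = r + k by ring]
  simp [Int.negOnePow_def, Units.smul_def]

/-- `binom(x - j + n, n) = ∑_k (-1)^k binom(j, k) binom(x + n - k, n - k)`. -/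
lemma choose_sub_add_eq_sum (n : ℕ) (x : ℕ) (j : ℤ) (hj : j ≤ x) :
    ((((x - j).toNat + n).choose n : ℕ) : ℤ) =
      ∑ k ∈ Finset.range (n + 1), (-1) ^ k * Ring.choose j k * ((x + (n - k)).choose (n - k) : ℤ) := by
  have hx : (((x : ℤ) - j).toNat : ℤ) = x - j := Int.toNat_of_nonneg (by omega)
  have h1 := ringChoose_neg_sub_one ((x : ℤ) - j) n
  rw [← hx, ringChoose_add_nat, hx] at h1
  -- Vandermonde for j + (-x - 1) = -(x - j) - 1. Upper negation on the left and in the second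
  -- factors on the right removes the negative arguments.
  have h2 := Ring.add_choose_eq (r := j) (s := -(x : ℤ) - 1) n (Commute.all _ _)
  rw [show j + (-(x : ℤ) - 1) = -((x : ℤ) - j) - 1 by ring, h1,
    Finset.Nat.sum_antidiagonal_eq_sum_range_succ_mk] at h2
  have h3 : ((-1 : ℤ)) ^ n * (-1) ^ n = 1 := by rw [← mul_pow]; simp
  have h5 : ((((x - j).toNat + n).choose n : ℕ) : ℤ) =
      (-1) ^ n * ((-1) ^ n * ((((x - j).toNat + n).choose n : ℕ) : ℤ)) := by
    rw [← mul_assoc, h3, one_mul]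
  rw [h5, h2, Finset.mul_sum]
  refine Finset.sum_congr rfl fun k hk => ?_
  have hk' : k ≤ n := by simpa [Nat.lt_succ_iff] using hk
  rw [ringChoose_neg_sub_one, ringChoose_add_nat]
  have h4 : ((-1 : ℤ)) ^ n * (-1) ^ (n - k) = (-1) ^ k := by
    rw [← pow_add, show n + (n - k) = k + 2 * (n - k) by omega, pow_add, pow_mul]
    simp
  calc _ = ((-1 : ℤ)) ^ n * (-1) ^ (n - k) * (Ring.choose j k * ((x + (n - k)).choose (n - k) : ℤ)) := by
        simp only [mul_assoc, mul_left_comm]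
    _ = _ := by rw [h4, mul_assoc]

lemma tendsto_choose_div_pow (j : ℕ) :
    Tendsto (fun x : ℕ => (((x + j).choose j : ℕ) : ℝ) / (x : ℝ) ^ j) atTop (𝓝 (1 / j.factorial)) := by
  have h : ∀ x : ℕ, (((x + j).choose j : ℕ) : ℝ) / (x : ℝ) ^ j =
      (∏ q ∈ Finset.range j, (((x : ℝ) + (q + 1)) / x)) / j.factorial := by
    intro x
    have : (((x + j).choose j : ℕ) : ℝ) = (∏ q ∈ Finset.range j, ((x : ℝ) + (q + 1))) / j.factorial := by
      rw [eq_div_iff (by positivity), ← Nat.cast_mul, mul_comm, ← Nat.descFactorial_eq_factorial_mul_choose,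
        Nat.add_descFactorial_eq_ascFactorial, Nat.ascFactorial_eq_prod_range]
      push_cast
      exact Finset.prod_congr rfl fun q _ => by ring
    rw [this, Finset.prod_div_distrib]
    simp
    ring
  simp_rw [h]
  refine Tendsto.div_const ?_ _
  rw [show 𝓝 (1 : ℝ) = 𝓝 (∏ q ∈ Finset.range j, (1 : ℝ)) by simp]
  refine tendsto_finsetProd _ fun q _ => ?_
  have h2 : Tendsto (fun x : ℕ => (1 : ℝ) + ((q : ℝ) + 1) / x) atTop (𝓝 (1 + 0)) :=
    tendsto_const_nhds.add (tendsto_const_div_atTop_nhds_zero_nat _)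
  rw [add_zero] at h2
  refine h2.congr' ?_
  filter_upwards [eventually_gt_atTop 0] with x hx
  have : (x : ℝ) ≠ 0 := by positivity
  field_simp

/-- A combination of the polynomials `binom(x + j, j)` which is `o(x ^ D)` has no terms with
`D ≤ j`. -/
lemma coeff_eq_zero_of_tendsto (m D : ℕ) (b : ℕ → ℝ)
    (h : Tendsto (fun x : ℕ => (∑ j ∈ Finset.range m, b j * ((x + j).choose j : ℕ)) / (x : ℝ) ^ D)
      atTop (𝓝 0)) : ∀ j < m, D ≤ j → b j = 0 := by
  induction m with
  | zero => simp
  | succ m ih =>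
    by_cases hD : D ≤ m
    · have hlow : ∀ j < m, Tendsto (fun x : ℕ => b j * ((x + j).choose j : ℕ) / (x : ℝ) ^ m)
          atTop (𝓝 0) := by
        intro j hj
        have h1 := ((tendsto_choose_div_pow j).const_mul (b j)).mul
          (((tendsto_pow_neg_atTop (𝕜 := ℝ) (n := m - j) (by omega)).comp
            tendsto_natCast_atTop_atTop))
        rw [mul_zero] at h1
        refine h1.congr' ?_
        filter_upwards [eventually_gt_atTop 0] with x hx
        have : (x : ℝ) ≠ 0 := by positivity
        simp only [Function.comp, zpow_neg, zpow_natCast]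
        rw [show (x : ℝ) ^ m = x ^ j * x ^ (m - j) by rw [← pow_add]; congr 1; omega]
        field_simp
      -- Since D ≤ m, dividing by x^m still gives limit 0. The lower terms are o(x^m), so the limit
      -- is also b_m / m!.
      have hm : b m = 0 := by
        have h1 : Tendsto (fun x : ℕ => (∑ j ∈ Finset.range (m + 1), b j * ((x + j).choose j : ℕ)) / (x : ℝ) ^ m)
            atTop (𝓝 0) := by
          refine squeeze_zero_norm' ?_ (tendsto_norm_zero.comp h)
          filter_upwards [eventually_ge_atTop 1] with x hx
          have hx' : (1 : ℝ) ≤ x := by exact_mod_cast hx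
          simp only [Function.comp, norm_div, norm_pow]
          have : (1 : ℝ) ≤ ‖(x : ℝ)‖ := by simpa using hx'
          gcongr
        have h2 := tendsto_finsetSum (Finset.range m) fun j hj => hlow j (Finset.mem_range.1 hj)
        have h3 := (h1.sub h2).sub ((tendsto_choose_div_pow m).const_mul (b m))
        have h4 := tendsto_nhds_unique (h3.congr (f₂ := fun _ => 0) ?_) tendsto_const_nhds
        · have : ((m.factorial : ℕ) : ℝ) ≠ 0 := by positivity
          field_simp at h4
          simpa using h4
        · intro x
          rw [Finset.sum_range_succ, ← Finset.sum_div]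
          ring
      intro j hj hDj
      rcases Nat.lt_succ_iff_lt_or_eq.1 hj with hj | rfl
      · exact ih (by simpa [Finset.sum_range_succ, hm] using h) j hj hDj
      · exact hm
    · intro j hj hDj
      omega

end Binomials

/-! ### Vanishing of minimal free resolutions -/

section FreeComplex

universe v w

variable {S : Type v} [CommRing S]

lemma mem_smul_top_iff_repr {ι F : Type*} [AddCommGroup F] [Module S F] (b : Module.Basis ι S F)
    (J : Ideal S) (y : F) : y ∈ J • (⊤ : Submodule S F) ↔ ∀ i, b.repr y i ∈ J := by
  constructor
  · intro h i
    refine Submodule.smul_induction_on h (fun r hr z _ => ?_) (fun z z' hz hz' => ?_)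
    · simpa using J.mul_mem_right _ hr
    · simpa using J.add_mem hz hz'
  · intro h
    rw [← b.linearCombination_repr y, Finsupp.linearCombination_apply]
    exact Submodule.sum_mem _ fun i _ => Submodule.smul_mem_smul (h i) trivial

lemma mem_smul_top_of_smul_mem {F : Type*} [AddCommGroup F] [Module S F] [Module.Free S F]
    {J : Ideal S} {x : S} (hx : ∀ a, x * a ∈ J → a ∈ J) {y : F}
    (hy : x • y ∈ J • (⊤ : Submodule S F)) : y ∈ J • (⊤ : Submodule S F) := by
  rw [mem_smul_top_iff_repr (Module.Free.chooseBasis S F)] at hy ⊢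
  exact fun i => hx _ (by simpa using hy i)

lemma subsingleton_of_smul_top_eq_top {F : Type*} [AddCommGroup F] [Module S F] [Module.Free S F]
    {J : Ideal S} (hJ : J ≠ ⊤) (h : ∀ y : F, y ∈ J • (⊤ : Submodule S F)) : Subsingleton F := by
  let b := Module.Free.chooseBasis S F
  have hempty : IsEmpty (Module.Free.ChooseBasisIndex S F) := by
    refine ⟨fun i => hJ ((Ideal.eq_top_iff_one J).2 ?_)⟩
    simpa using (mem_smul_top_iff_repr b J (b i)).1 (h (b i)) i
  exact b.repr.toEquiv.subsingleton

variable (J : ℕ → Ideal S) (x : ℕ → S) (n : ℕ)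

/-- In an exact complex of free modules, the boundaries of degree `j ≥ l` that are divisible by
the ideal of a regular sequence of length `l` are boundaries of divisible elements. -/
lemma exists_mem_smul_top_of_exact (hJ0 : J 0 = ⊥)
    (hJ : ∀ l < n, J (l + 1) = J l ⊔ Ideal.span {x l})
    (hreg : ∀ l < n, ∀ a, x l * a ∈ J l → a ∈ J l)
    (F : ℕ → ModuleCat.{w} S) (d : ∀ i, F (i + 1) →ₗ[S] F i)
    (hfree : ∀ i, Module.Free S (F i)) (hex : ∀ i, Function.Exact (d (i + 1)) (d i))
    (l : ℕ) (hl : l ≤ n) (j : ℕ) (hj : l ≤ j) (u : F (j + 1))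
    (hu : d j u ∈ J l • (⊤ : Submodule S (F j))) :
    ∃ u' ∈ J l • (⊤ : Submodule S (F (j + 1))), d j u' = d j u := by
  induction l generalizing j with
  | zero =>
    rw [hJ0, Submodule.bot_smul, Submodule.mem_bot] at hu
    exact ⟨0, Submodule.zero_mem _, by rw [map_zero, hu]⟩
  | succ l ih =>
    obtain ⟨j, rfl⟩ : ∃ j', j = j' + 1 := ⟨j - 1, by omega⟩
    rw [hJ l hl, Submodule.sup_smul, Submodule.mem_sup] at hu
    obtain ⟨y, hy, z, hz, hyz⟩ := hu
    rw [Submodule.ideal_span_singleton_smul, Submodule.mem_smul_pointwise_iff_exists] at hz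
    obtain ⟨w, -, rfl⟩ := hz
    -- The boundary of u is y + x_l w with y in J_l F. Hence x_l · dw = -dy lies in J_l F, and by
    -- regularity so does dw. Induction one homological degree lower (whence the condition l ≤ j)
    -- gives w' in J_l F with dw' = dw, so w - w' = dt. Now u - x_l t has boundary y + x_l w' in J_l
    -- F, and induction applies again.
    have h1 : d j y + x l • d j w = 0 := by
      rw [← map_smul, ← map_add, hyz]
      exact (hex j).apply_apply_eq_zero u
    have h2 : d j y ∈ J l • (⊤ : Submodule S (F j)) := by
      have := Submodule.map_smul'' (J l) (⊤ : Submodule S (F (j + 1))) (d j)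
      have h3 : d j y ∈ Submodule.map (d j) (J l • (⊤ : Submodule S (F (j + 1)))) := ⟨y, hy, rfl⟩
      rw [this] at h3
      exact Submodule.smul_mono le_rfl le_top h3
    have h3 : d j w ∈ J l • (⊤ : Submodule S (F j)) := by
      have := hfree j
      refine mem_smul_top_of_smul_mem (hreg l hl) (x := x l) ?_
      rw [eq_neg_of_add_eq_zero_right h1]
      exact Submodule.neg_mem _ h2
    obtain ⟨w', hw', hdw⟩ := ih (by omega) j (by omega) w h3
    obtain ⟨t, ht⟩ := (hex j (w - w')).1 (by rw [map_sub, hdw, sub_self])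
    have h4 : d (j + 1) (u - x l • t) = y + x l • w' := by
      rw [map_sub, map_smul, ht, ← hyz, smul_sub]
      abel
    obtain ⟨z, hz, hdz⟩ := ih (by omega) (j + 1) (by omega) (u - x l • t) (by
      rw [h4]
      exact Submodule.add_mem _ hy (Submodule.smul_mem _ _ hw'))
    refine ⟨z + x l • t, ?_, by rw [map_add, hdz, map_sub, map_smul, sub_add_cancel]⟩
    rw [hJ l hl, Submodule.sup_smul]
    refine Submodule.add_mem_sup hz ?_
    rw [Submodule.ideal_span_singleton_smul]
    exact Submodule.smul_mem_pointwise_smul _ _ _ trivial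

/-- A minimal exact complex of free modules vanishes beyond the length of a regular sequence
generating the ideal. -/
lemma subsingleton_of_exact (hJ0 : J 0 = ⊥)
    (hJ : ∀ l < n, J (l + 1) = J l ⊔ Ideal.span {x l})
    (hreg : ∀ l < n, ∀ a, x l * a ∈ J l → a ∈ J l) (hJn : J n ≠ ⊤)
    (F : ℕ → ModuleCat.{w} S) (d : ∀ i, F (i + 1) →ₗ[S] F i)
    (hfree : ∀ i, Module.Free S (F i)) (hex : ∀ i, Function.Exact (d (i + 1)) (d i))
    (hmin : ∀ i, LinearMap.range (d i) ≤ J n • ⊤) (i : ℕ) (hi : n < i) : Subsingleton (F i) := by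
  obtain ⟨i, rfl⟩ : ∃ j, i = j + 1 := ⟨i - 1, by omega⟩
  have := hfree (i + 1)
  refine subsingleton_of_smul_top_eq_top hJn fun y => ?_
  -- By minimality dy lies in J_n F, so y can be corrected to y' in J_n F with the same boundary.
  -- The cycle y - y' is a boundary, hence also in J_n F; thus F_{i+1} = J_n F_{i+1}.
  obtain ⟨y', hy', hd⟩ := exists_mem_smul_top_of_exact J x n hJ0 hJ hreg F d hfree hex n le_rfl i
    (by omega) y (hmin i ⟨y, rfl⟩)
  have h : y - y' ∈ J n • (⊤ : Submodule S (F (i + 1))) :=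
    hmin (i + 1) ((hex i (y - y')).1 (by rw [map_sub, hd, sub_self]))
  simpa using Submodule.add_mem _ h hy'

/-- The terms of the mapping cone of an endomorphism of a complex. -/
def coneObj (F : ℕ → ModuleCat.{w} S) : ℕ → ModuleCat.{w} S
  | 0 => F 0
  | i + 1 => ModuleCat.of S (F (i + 1) × F i)

/-- The differential of the mapping cone of the multiplication by `f`. -/
def coneDiff (f : S) (F : ℕ → ModuleCat.{w} S) (d : ∀ i, F (i + 1) →ₗ[S] F i) :
    ∀ i, coneObj F (i + 1) →ₗ[S] coneObj F i
  | 0 => (d 0).coprod (f • LinearMap.id)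
  | i + 1 => ((d (i + 1)).coprod (f • LinearMap.id)).prod (-(d i ∘ₗ LinearMap.snd S _ _))

lemma coneDiff_zero_apply (f : S) (F : ℕ → ModuleCat.{w} S) (d : ∀ i, F (i + 1) →ₗ[S] F i)
    (u : F 1) (y : F 0) :
    coneDiff f F d 0 ((u, y) : F 1 × F 0) = (d 0 u + f • y : F 0) := rfl

lemma coneDiff_succ_apply (f : S) (F : ℕ → ModuleCat.{w} S) (d : ∀ i, F (i + 1) →ₗ[S] F i)
    (i : ℕ) (u : F (i + 2)) (y : F (i + 1)) :
    coneDiff f F d (i + 1) ((u, y) : F (i + 2) × F (i + 1)) =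
      ((d (i + 1) u + f • y, -d i y) : F (i + 1) × F i) := rfl

lemma free_coneObj (F : ℕ → ModuleCat.{w} S) (hfree : ∀ i, Module.Free S (F i)) :
    ∀ i, Module.Free S (coneObj F i)
  | 0 => hfree 0
  | i + 1 => by
    have := hfree i
    have := hfree (i + 1)
    exact inferInstanceAs (Module.Free S (F (i + 1) × F i))

/-- In the long exact sequence of the cone, homology in degree 1 is the kernel of f on the cokernel
of d_0, which vanishes by regularity. In higher degrees exactness of F suffices. -/
lemma exact_coneDiff (f : S) (F : ℕ → ModuleCat.{w} S) (d : ∀ i, F (i + 1) →ₗ[S] F i)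
    (hex : ∀ i, Function.Exact (d (i + 1)) (d i))
    (hf : IsSMulRegular (F 0 ⧸ LinearMap.range (d 0)) f) :
    ∀ i, Function.Exact (coneDiff f F d (i + 1)) (coneDiff f F d i)
  | 0 => by
    rintro ⟨u, y⟩
    rw [coneDiff_zero_apply]
    constructor
    · intro h
      have hy : y ∈ LinearMap.range (d 0) := by
        rw [← Submodule.Quotient.mk_eq_zero]
        refine hf ?_
        simp only [smul_zero]
        rw [← Submodule.Quotient.mk_smul, Submodule.Quotient.mk_eq_zero,
          eq_neg_of_add_eq_zero_right h]
        exact ⟨-u, map_neg _ _⟩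
      obtain ⟨w, rfl⟩ := hy
      obtain ⟨z, hz⟩ := (hex 0 (u + f • w)).1 (by rw [map_add, map_smul]; exact h)
      refine ⟨((z, -w) : F 2 × F 1), ?_⟩
      rw [coneDiff_succ_apply, hz]
      exact Prod.ext (by simp) (by simp)
    · rintro ⟨⟨z, w⟩, h⟩
      rw [coneDiff_succ_apply] at h
      obtain ⟨h1, h2⟩ := Prod.ext_iff.1 h
      simp only at h1 h2
      rw [← h1, ← h2, map_add, (hex 0).apply_apply_eq_zero, map_smul, zero_add, smul_neg,
        add_neg_cancel]
      rfl
  | i + 1 => by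
    rintro ⟨u, y⟩
    rw [coneDiff_succ_apply]
    constructor
    · intro h
      obtain ⟨h1, h2⟩ := Prod.ext_iff.1 h
      obtain ⟨w, rfl⟩ := (hex i y).1 (neg_eq_zero.1 h2)
      obtain ⟨z, hz⟩ := (hex (i + 1) (u + f • w)).1 (by rw [map_add, map_smul]; exact h1)
      refine ⟨((z, -w) : F (i + 3) × F (i + 2)), ?_⟩
      rw [coneDiff_succ_apply, hz]
      exact Prod.ext (by simp) (by simp)
    · rintro ⟨⟨z, w⟩, h⟩
      rw [coneDiff_succ_apply] at h
      obtain ⟨h1, h2⟩ := Prod.ext_iff.1 h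
      simp only at h1 h2
      rw [← h1, ← h2, map_add, (hex (i + 1)).apply_apply_eq_zero, map_smul, zero_add, smul_neg,
        add_neg_cancel, map_neg, (hex i).apply_apply_eq_zero, neg_zero, neg_zero]
      rfl

lemma mk_mem_smul_top {M N : Type*} [AddCommGroup M] [Module S M] [AddCommGroup N] [Module S N]
    {I : Ideal S} {y : M} {z : N} (hy : y ∈ I • (⊤ : Submodule S M))
    (hz : z ∈ I • (⊤ : Submodule S N)) : (y, z) ∈ I • (⊤ : Submodule S (M × N)) := by
  have h1 : (y, (0 : N)) ∈ I • (⊤ : Submodule S (M × N)) := by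
    have : LinearMap.inl S M N y ∈ Submodule.map (LinearMap.inl S M N) (I • ⊤) := ⟨y, hy, rfl⟩
    rw [Submodule.map_smul''] at this
    exact Submodule.smul_mono le_rfl le_top this
  have h2 : ((0 : M), z) ∈ I • (⊤ : Submodule S (M × N)) := by
    have : LinearMap.inr S M N z ∈ Submodule.map (LinearMap.inr S M N) (I • ⊤) := ⟨z, hz, rfl⟩
    rw [Submodule.map_smul''] at this
    exact Submodule.smul_mono le_rfl le_top this
  simpa using Submodule.add_mem _ h1 h2

lemma range_coneDiff_le (I : Ideal S) (f : S) (hf : f ∈ I) (F : ℕ → ModuleCat.{w} S)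
    (d : ∀ i, F (i + 1) →ₗ[S] F i) (hmin : ∀ i, LinearMap.range (d i) ≤ I • ⊤) :
    ∀ i, LinearMap.range (coneDiff f F d i) ≤ I • ⊤
  | 0 => by
    rintro _ ⟨⟨u, y⟩, rfl⟩
    exact Submodule.add_mem _ (hmin 0 ⟨u, rfl⟩) (Submodule.smul_mem_smul hf trivial)
  | i + 1 => by
    rintro _ ⟨⟨u, y⟩, rfl⟩
    exact mk_mem_smul_top
      (Submodule.add_mem _ (hmin (i + 1) ⟨u, rfl⟩) (Submodule.smul_mem_smul hf trivial))
      (Submodule.neg_mem _ (hmin i ⟨y, rfl⟩))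

/-- The augmentation of the mapping cone of the multiplication by `f`. -/
def coneAug (f : S) (F : ℕ → ModuleCat.{w} S) (d : ∀ i, F (i + 1) →ₗ[S] F i) :
    coneObj F 0 →ₗ[S] QuotSMulTop f (F 0 ⧸ LinearMap.range (d 0)) :=
  show F 0 →ₗ[S] QuotSMulTop f (F 0 ⧸ LinearMap.range (d 0)) from
    (Submodule.mkQ _) ∘ₗ (Submodule.mkQ _)

/-- The cone of the multiplication by `f` resolves the quotient by `f`. -/
def coneQuotientEquiv (f : S) (F : ℕ → ModuleCat.{w} S) (d : ∀ i, F (i + 1) →ₗ[S] F i) :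
    (coneObj F 0 ⧸ LinearMap.range (coneDiff f F d 0)) ≃ₗ[S]
      QuotSMulTop f (F 0 ⧸ LinearMap.range (d 0)) :=
  have hg : Function.Surjective (coneAug f F d) :=
    fun q => by
      obtain ⟨q, rfl⟩ := Submodule.mkQ_surjective _ q
      obtain ⟨y, rfl⟩ := Submodule.mkQ_surjective _ q
      exact ⟨y, rfl⟩
  have hker : LinearMap.range (coneDiff f F d 0) = LinearMap.ker (coneAug f F d) := by
    refine Submodule.ext fun (y : F 0) => ?_
    change _ ↔ (Submodule.Quotient.mk (Submodule.Quotient.mk y) :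
      QuotSMulTop f (F 0 ⧸ LinearMap.range (d 0))) = 0
    rw [ Submodule.Quotient.mk_eq_zero,
      Submodule.mem_smul_pointwise_iff_exists]
    constructor
    · rintro ⟨⟨u, z⟩, rfl⟩
      refine ⟨Submodule.Quotient.mk z, trivial, ?_⟩
      rw [coneDiff_zero_apply, ← Submodule.Quotient.mk_smul]
      refine (Submodule.Quotient.eq _).2 ⟨-u, ?_⟩
      rw [map_neg]
      abel
    · rintro ⟨z, -, hz⟩
      obtain ⟨z, rfl⟩ := Submodule.mkQ_surjective _ z
      rw [Submodule.mkQ_apply, ← Submodule.Quotient.mk_smul] at hz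
      obtain ⟨u, hu⟩ := (Submodule.Quotient.eq _).1 hz
      refine ⟨((-u, z) : F 1 × F 0), ?_⟩
      rw [coneDiff_zero_apply, map_neg, hu]
      abel
  (Submodule.quotEquivOfEq _ _ hker).trans ((coneAug f F d).quotKerEquivOfSurjective hg)

/-- The length of a minimal free resolution is bounded by `n` minus the length of a regular
sequence. -/
lemma subsingleton_of_isWeaklyRegular (hJ0 : J 0 = ⊥)
    (hJ : ∀ l < n, J (l + 1) = J l ⊔ Ideal.span {x l})
    (hreg : ∀ l < n, ∀ a, x l * a ∈ J l → a ∈ J l) (hJn : J n ≠ ⊤)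
    (rs : List S) (hrs : ∀ f ∈ rs, f ∈ J n)
    (F : ℕ → ModuleCat.{w} S) (d : ∀ i, F (i + 1) →ₗ[S] F i)
    (hfree : ∀ i, Module.Free S (F i)) (hex : ∀ i, Function.Exact (d (i + 1)) (d i))
    (hmin : ∀ i, LinearMap.range (d i) ≤ J n • ⊤)
    (hF : RingTheory.Sequence.IsWeaklyRegular (F 0 ⧸ LinearMap.range (d 0)) rs)
    (i : ℕ) (hi : n < i + rs.length) : Subsingleton (F i) := by
  induction rs generalizing F i with
  | nil => exact subsingleton_of_exact J x n hJ0 hJ hreg hJn F d hfree hex hmin i (by simpa using hi)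
  | cons f rs ih =>
    rw [RingTheory.Sequence.isWeaklyRegular_cons_iff] at hF
    -- The cone is again minimal, resolves the quotient by f, and contains F_i as a summand in
    -- degree i + 1. So one regular element is traded for one homological degree, until the case
    -- without regular elements is reached.
    have hsub : Subsingleton (coneObj F (i + 1)) := by
      refine ih (fun g hg => hrs g (List.mem_cons_of_mem _ hg)) (coneObj F) (coneDiff f F d)
        (free_coneObj F hfree) (exact_coneDiff f F d hex hF.1)
        (range_coneDiff_le _ f (hrs f List.mem_cons_self) F d hmin) ?_ (i + 1) ?_
      · exact ((coneQuotientEquiv f F d).isWeaklyRegular_congr rs).2 hF.2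
      · simp only [List.length_cons] at hi
        omega
    have hsub' : Subsingleton (F (i + 1) × F i) := hsub
    exact (Prod.mk_right_injective (0 : F (i + 1))).subsingleton

end FreeComplex

/-! ### Projective dimension over the polynomial ring -/

section PolynomialRing

universe u

variable (K : Type u) [Field K] (n : ℕ)

/-- The ideal generated by the first `l` variables. -/
def varIdeal (l : ℕ) : Ideal (MvPolynomial (Fin n) K) :=
  Ideal.span (X '' {i : Fin n | (i : ℕ) < l})

lemma varIdeal_zero : varIdeal K n 0 = ⊥ := by
  simp [varIdeal]

/-- The variables, extended by zero to a sequence indexed by `ℕ`. -/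
def varSeq (l : ℕ) : MvPolynomial (Fin n) K := if h : l < n then X ⟨l, h⟩ else 0

lemma varIdeal_succ (l : ℕ) (hl : l < n) :
    varIdeal K n (l + 1) = varIdeal K n l ⊔ Ideal.span {varSeq K n l} := by
  unfold varIdeal varSeq
  rw [dif_pos hl, ← Ideal.span_union, ← Set.image_singleton, ← Set.image_union]
  congr 2
  ext i
  simp only [Set.mem_ofPred_eq, Set.mem_union, Set.mem_singleton_iff, Fin.ext_iff]
  omega

/-- Membership in an ideal generated by variables is tested monomial by monomial, and multiplying by
a further variable does not change the test. -/
lemma mem_varIdeal_of_varSeq_mul_mem (l : ℕ) (hl : l < n) (a : MvPolynomial (Fin n) K)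
    (h : varSeq K n l * a ∈ varIdeal K n l) : a ∈ varIdeal K n l := by
  unfold varIdeal varSeq at *
  rw [dif_pos hl, mem_ideal_span_X_image] at h
  rw [mem_ideal_span_X_image]
  intro t ht
  obtain ⟨i, hi, hti⟩ := h (Finsupp.single ⟨l, hl⟩ 1 + t) (by
    rw [mem_support_iff, coeff_X_mul]
    exact mem_support_iff.1 ht)
  refine ⟨i, hi, ?_⟩
  have : (⟨l, hl⟩ : Fin n) ≠ i := by
    rintro rfl
    simp at hi
  simpa [Finsupp.single_apply, this] using hti

lemma mem_varIdeal_iff (f : MvPolynomial (Fin n) K) :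
    f ∈ varIdeal K n n ↔ constantCoeff f = 0 := by
  unfold varIdeal
  rw [mem_ideal_span_X_image]
  constructor
  · intro h
    by_contra h0
    obtain ⟨i, -, hi⟩ := h 0 (by rw [mem_support_iff]; exact h0)
    simp at hi
  · intro h t ht
    have : t ≠ 0 := by
      rintro rfl
      exact (mem_support_iff.1 ht) h
    obtain ⟨i, hi⟩ := Finsupp.ne_iff.1 this
    exact ⟨i, i.2, by simpa using hi⟩

lemma varIdeal_ne_top : varIdeal K n n ≠ ⊤ := by
  rw [Ne, Ideal.eq_top_iff_one, mem_varIdeal_iff]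
  simp

variable {K n}

lemma mem_varIdeal_smul_top_iff {r : ℕ} (y : Fin r → MvPolynomial (Fin n) K) :
    y ∈ varIdeal K n n • (⊤ : Submodule (MvPolynomial (Fin n) K) (Fin r → MvPolynomial (Fin n) K)) ↔
      ∀ b, constantCoeff (y b) = 0 := by
  rw [mem_smul_top_iff_repr (Pi.basisFun _ _)]
  simp [mem_varIdeal_iff]

variable {N : Type u} [AddCommGroup N] [Module K N] [Module (MvPolynomial (Fin n) K) N]
  {𝒩 : Grading K n N}

lemma MinimalResolution.range_diff_le (F : MinimalResolution 𝒩) (i : ℕ) :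
    LinearMap.range (F.diff i) ≤ varIdeal K n n • ⊤ := by
  rintro _ ⟨y, rfl⟩
  rw [pi_eq_sum_univ' y, map_sum]
  refine Submodule.sum_mem _ fun a _ => ?_
  rw [map_smul]
  refine Submodule.smul_mem _ _ ((mem_varIdeal_smul_top_iff _).2 fun b => ?_)
  exact F.minimal i a b

/-- The projective dimension of a Cohen-Macaulay module is at most its codimension. -/
lemma MinimalResolution.rank_eq_zero (F : MinimalResolution 𝒩) {s : ℕ}
    (hCM : IsCohenMacaulay K n N) (hs : HasCodim K n N s) (i : ℕ) (hi : s < i) :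
    F.rank i = 0 := by
  obtain ⟨r, hr, hreg, hdim⟩ := hCM
  unfold HasCodim at hs
  rw [hdim] at hs
  -- Depth equals dimension, so the regular sequence has length n - s and the bound n - length is s.
  have hlen : r.length + s = n := by exact_mod_cast hs
  let C : ℕ → ModuleCat.{u} (MvPolynomial (Fin n) K) := fun i =>
    ModuleCat.of _ (Fin (F.rank i) → MvPolynomial (Fin n) K)
  have hsub : Subsingleton (C i) := by
    refine subsingleton_of_isWeaklyRegular (varIdeal K n) (varSeq K n) n (varIdeal_zero K n)
      (varIdeal_succ K n) (mem_varIdeal_of_varSeq_mul_mem K n) (varIdeal_ne_top K n) r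
      (fun f hf => (mem_varIdeal_iff K n f).2 (hr f hf)) C F.diff
      (fun i => inferInstanceAs (Module.Free _ (Fin (F.rank i) → MvPolynomial (Fin n) K)))
      F.exact_diff F.range_diff_le ?_ i (by omega)
    let e : (C 0 ⧸ LinearMap.range (F.diff 0)) ≃ₗ[MvPolynomial (Fin n) K] N :=
      (Submodule.quotEquivOfEq _ _ (LinearMap.exact_iff.1 F.exact_aug).symm).trans
        (F.aug.quotKerEquivOfSurjective F.aug_surjective)
    exact (e.isWeaklyRegular_congr r).2 hreg.toIsWeaklyRegular
  by_contra h
  have : Nonempty (Fin (F.rank i)) := ⟨⟨0, Nat.pos_of_ne_zero h⟩⟩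
  exact not_subsingleton (Fin (F.rank i) → MvPolynomial (Fin n) K) hsub

end PolynomialRing

/-! ### Truncations of graded modules -/

section Truncation

universe u

variable {K : Type u} [Field K] {n : ℕ}

/-- The `K`-linear projection of polynomials that keeps the monomials in `s`. -/
def polyTrunc (s : Set (Fin n →₀ ℕ)) : MvPolynomial (Fin n) K →ₗ[K] MvPolynomial (Fin n) K :=
  open Classical in
  (basisMonomials (Fin n) K).constr K fun t => if t ∈ s then monomial t 1 else 0

lemma polyTrunc_monomial (s : Set (Fin n →₀ ℕ)) [DecidablePred (· ∈ s)] (t : Fin n →₀ ℕ) :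
    polyTrunc s (monomial t (1 : K)) = if t ∈ s then monomial t 1 else 0 := by
  classical
  have := (basisMonomials (Fin n) K).constr_basis K
    (fun t => if t ∈ s then monomial t (1 : K) else 0) t
  rw [coe_basisMonomials] at this
  unfold polyTrunc
  convert this

lemma polyTrunc_mem (s : Set (Fin n →₀ ℕ)) (p : MvPolynomial (Fin n) K) :
    polyTrunc s p ∈ restrictSupport K s := by
  classical
  unfold polyTrunc
  rw [Module.Basis.constr_apply]
  refine Submodule.sum_mem _ fun t _ => Submodule.smul_mem _ _ ?_
  split_ifs with h
  · simp [h]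
  · exact Submodule.zero_mem _

lemma polyTrunc_eq_self {s : Set (Fin n →₀ ℕ)} {p : MvPolynomial (Fin n) K}
    (hp : p ∈ restrictSupport K s) : polyTrunc s p = p := by
  classical
  rw [restrictSupport_eq_span] at hp
  refine LinearMap.eqOn_span (f := polyTrunc s) (g := LinearMap.id) ?_ hp
  rintro _ ⟨t, ht, rfl⟩
  simp [polyTrunc_monomial, ht]

lemma polyTrunc_eq_zero {s s' : Set (Fin n →₀ ℕ)} (hss : Disjoint s s')
    {p : MvPolynomial (Fin n) K} (hp : p ∈ restrictSupport K s') : polyTrunc s p = 0 := by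
  classical
  rw [restrictSupport_eq_span] at hp
  refine LinearMap.eqOn_span (f := polyTrunc s) (g := 0) ?_ hp
  rintro _ ⟨t, ht, rfl⟩
  simp [polyTrunc_monomial, hss.notMem_of_mem_right ht]

/-- The exponents of the monomials of degree at most `x` in `S(-c)`. -/
def truncSet (n : ℕ) (c x : ℤ) : Set (Fin n →₀ ℕ) := {t | c + (Finsupp.degree t : ℕ) ≤ x}

variable {r : ℕ}

/-- The elements of `⨁_a S(-c_a)` of degree at most `x`. -/
def freePart (K : Type u) [Field K] (n : ℕ) {r : ℕ} (c : Fin r → ℤ) (x : ℤ) :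
    Submodule K (Fin r → MvPolynomial (Fin n) K) :=
  Submodule.pi Set.univ fun a => restrictSupport K (truncSet n (c a) x)

lemma mem_freePart {c : Fin r → ℤ} {x : ℤ} {v : Fin r → MvPolynomial (Fin n) K} :
    v ∈ freePart K n c x ↔ ∀ a, v a ∈ restrictSupport K (truncSet n (c a) x) := by
  simp [freePart]

/-- The projection of `⨁_a S(-c_a)` to the elements of degree at most `x`. -/
def freeTrunc (c : Fin r → ℤ) (x : ℤ) :
    (Fin r → MvPolynomial (Fin n) K) →ₗ[K] (Fin r → MvPolynomial (Fin n) K) :=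
  LinearMap.pi fun a => polyTrunc (truncSet n (c a) x) ∘ₗ LinearMap.proj a

lemma freeTrunc_mem (c : Fin r → ℤ) (x : ℤ) (v : Fin r → MvPolynomial (Fin n) K) :
    freeTrunc c x v ∈ freePart K n c x :=
  mem_freePart.2 fun _ => polyTrunc_mem _ _

lemma freeTrunc_eq_self {c : Fin r → ℤ} {x : ℤ} {v : Fin r → MvPolynomial (Fin n) K}
    (hv : v ∈ freePart K n c x) : freeTrunc c x v = v :=
  funext fun a => polyTrunc_eq_self (mem_freePart.1 hv a)

lemma freeTrunc_of_homogeneous (c : Fin r → ℤ) (x j : ℤ) (v : Fin r → MvPolynomial (Fin n) K)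
    (hv : ∀ a, IsHomogeneousInt (v a) (j - c a)) :
    freeTrunc c x v = if j ≤ x then v else 0 := by
  split_ifs with h
  · refine freeTrunc_eq_self (mem_freePart.2 fun a t ht => ?_)
    have := hv a t ht
    change c a + _ ≤ x
    omega
  · funext a
    refine polyTrunc_eq_zero (s' := {t | t ∉ truncSet n (c a) x}) ?_ fun t ht => ?_
    · exact Set.disjoint_left.2 fun t h h' => h' h
    · have := hv a t ht
      change ¬ (c a + _ ≤ x)
      omega

lemma freeTrunc_single_monomial (c : Fin r → ℤ) (x : ℤ) (a : Fin r) (t : Fin n →₀ ℕ) :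
    freeTrunc c x (Pi.single a (monomial t (1 : K))) =
      if c a + (Finsupp.degree t : ℕ) ≤ x then Pi.single a (monomial t 1) else 0 := by
  refine freeTrunc_of_homogeneous c x _ _ fun b t' ht' => ?_
  by_cases hb : b = a
  · subst hb
    rw [Pi.single_eq_same] at ht'
    have := Finset.mem_singleton.1 (support_monomial_subset ht')
    subst this
    omega
  · rw [Pi.single_eq_of_ne hb] at ht'
    simp at ht'

/-- A linear map on `⨁_a S(-c_a)` commutes with truncation if it does so on monomials. -/
lemma comm_freeTrunc {M : Type*} [AddCommGroup M] [Module K M] (c : Fin r → ℤ) (x : ℤ)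
    (f : (Fin r → MvPolynomial (Fin n) K) →ₗ[K] M) (q : M →ₗ[K] M)
    (h : ∀ a t, q (f (Pi.single a (monomial t 1))) =
      if c a + (Finsupp.degree t : ℕ) ≤ x then f (Pi.single a (monomial t 1)) else 0)
    (v : Fin r → MvPolynomial (Fin n) K) : q (f v) = f (freeTrunc c x v) := by
  suffices q ∘ₗ f = f ∘ₗ freeTrunc c x from LinearMap.congr_fun this v
  refine LinearMap.pi_ext' fun a => (basisMonomials (Fin n) K).ext fun t => ?_
  simp only [coe_basisMonomials, LinearMap.comp_apply, LinearMap.single_apply]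
  rw [h, freeTrunc_single_monomial]
  split_ifs <;> simp

lemma isHomogeneousInt_monomial_mul {p : MvPolynomial (Fin n) K} {e : ℤ}
    (hp : IsHomogeneousInt p e) (t : Fin n →₀ ℕ) :
    IsHomogeneousInt (monomial t 1 * p) (e + (Finsupp.degree t : ℕ)) := by
  intro m hm
  rw [mem_support_iff, coeff_monomial_mul'] at hm
  split_ifs at hm with htm
  · have := hp (m - t) (by rw [mem_support_iff]; simpa using hm)
    have h2 : Finsupp.degree m = Finsupp.degree (m - t) + Finsupp.degree t := by
      rw [← map_add, tsub_add_cancel_of_le htm]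
    rw [h2]
    push_cast
    rw [this]
  · exact absurd rfl hm

variable {N : Type u} [AddCommGroup N] [Module K N] [Module (MvPolynomial (Fin n) K) N]
  (𝒩 : Grading K n N)

/-- The projection of a graded module to its elements of degree at most `x`. -/
def Grading.trunc (x : ℤ) : N →ₗ[K] N :=
  DirectSum.toModule K ℤ N (fun j => if j ≤ x then (𝒩.piece j).subtype else 0) ∘ₗ
    (LinearEquiv.ofBijective (DirectSum.coeLinearMap 𝒩.piece) 𝒩.isInternal).symm.toLinearMap

lemma Grading.trunc_of_mem (x j : ℤ) {v : N} (hv : v ∈ 𝒩.piece j) :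
    𝒩.trunc x v = if j ≤ x then v else 0 := by
  have h : (LinearEquiv.ofBijective (DirectSum.coeLinearMap 𝒩.piece) 𝒩.isInternal).symm v =
      DirectSum.lof K ℤ (fun j => 𝒩.piece j) j ⟨v, hv⟩ := by
    rw [LinearEquiv.symm_apply_eq]
    exact (DirectSum.coeLinearMap_lof 𝒩.piece j ⟨v, hv⟩).symm
  simp only [Grading.trunc, LinearMap.comp_apply, LinearEquiv.coe_coe, h, DirectSum.toModule_lof]
  split_ifs <;> simp

variable {𝒩} (F : MinimalResolution 𝒩)

/-- The differentials have degree 0. This commutation is what keeps the resolution exact after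
restriction to degrees at most x. -/
lemma MinimalResolution.diff_trunc (i : ℕ) (x : ℤ)
    (v : Fin (F.rank (i + 1)) → MvPolynomial (Fin n) K) :
    freeTrunc (F.shift i) x (F.diff i v) = F.diff i (freeTrunc (F.shift (i + 1)) x v) := by
  refine comm_freeTrunc (F.shift (i + 1)) x ((F.diff i).restrictScalars K) _ (fun a t => ?_) v
  refine freeTrunc_of_homogeneous _ _ _ _ fun b => ?_
  have h : Pi.single a (monomial t (1 : K)) =
      (monomial t (1 : K)) • (Pi.single a 1 : Fin (F.rank (i + 1)) → MvPolynomial (Fin n) K) := by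
    rw [← Pi.single_smul, smul_eq_mul, mul_one]
  rw [LinearMap.restrictScalars_apply, h, map_smul, Pi.smul_apply, smul_eq_mul]
  have := isHomogeneousInt_monomial_mul (F.diff_degree i a b) t
  rwa [show F.shift (i + 1) a - F.shift i b + ((Finsupp.degree t : ℕ) : ℤ) =
    F.shift (i + 1) a + ((Finsupp.degree t : ℕ) : ℤ) - F.shift i b by ring] at this

lemma MinimalResolution.aug_single_mem (a : Fin (F.rank 0)) (t : Fin n →₀ ℕ) :
    F.aug (Pi.single a (monomial t (1 : K))) ∈ 𝒩.piece (F.shift 0 a + (Finsupp.degree t : ℕ)) := by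
  have h : Pi.single a (monomial t (1 : K)) =
      (monomial t (1 : K)) • (Pi.single a 1 : Fin (F.rank 0) → MvPolynomial (Fin n) K) := by
    rw [← Pi.single_smul, smul_eq_mul, mul_one]
  rw [h, map_smul]
  exact 𝒩.smul_mem _ _ _ _ (isHomogeneous_monomial _ rfl) (F.aug_degree a)

lemma MinimalResolution.aug_trunc [IsScalarTower K (MvPolynomial (Fin n) K) N] (x : ℤ)
    (v : Fin (F.rank 0) → MvPolynomial (Fin n) K) :
    𝒩.trunc x (F.aug v) = F.aug (freeTrunc (F.shift 0) x v) :=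
  comm_freeTrunc (F.shift 0) x (F.aug.restrictScalars K) _
    (fun a t => 𝒩.trunc_of_mem _ _ (F.aug_single_mem a t)) v

end Truncation

/-! ### Counting monomials of bounded degree -/

section Counting

universe u

/-- Tuples with sum at most `e` correspond to tuples with one more entry and sum `e`. -/
def finsuppDegreeLeEquiv (n e : ℕ) :
    {t : Fin n →₀ ℕ // Finsupp.degree t ≤ e} ≃ {P : Fin (n + 1) → ℕ // ∑ i, P i = e} where
  toFun t := ⟨Fin.cons (e - Finsupp.degree t.1) t.1, by
    rw [Fin.sum_univ_succ]
    simp only [Fin.cons_zero, Fin.cons_succ]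
    rw [← Finsupp.degree_eq_sum]
    exact Nat.sub_add_cancel t.2⟩
  invFun P := ⟨Finsupp.equivFunOnFinite.symm (fun i => P.1 i.succ), by
    have := P.2
    rw [Fin.sum_univ_succ] at this
    rw [Finsupp.degree_eq_sum]
    simp only [Finsupp.equivFunOnFinite_symm_apply_apply]
    omega⟩
  left_inv t := by
    ext i
    simp
  right_inv P := by
    ext i
    have := P.2
    rw [Fin.sum_univ_succ] at this
    induction i using Fin.cases with
    | zero =>
      simp only [Fin.cons_zero]
      rw [Finsupp.degree_eq_sum]
      simp only [Finsupp.equivFunOnFinite_symm_apply_apply]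
      omega
    | succ i => simp

lemma card_finsupp_degree_le (n e : ℕ) :
    Nat.card {t : Fin n →₀ ℕ // Finsupp.degree t ≤ e} = (e + n).choose n := by
  rw [Nat.card_congr ((finsuppDegreeLeEquiv n e).trans (Sym.equivNatSumOfFintype (Fin (n + 1)) e).symm),
    Nat.card_eq_fintype_card, Sym.card_sym_eq_multichoose, Nat.multichoose_eq, Fintype.card_fin,
    show n + 1 + e - 1 = e + n by omega]
  exact (Nat.choose_symm_add).trans rfl

variable (K : Type u) [Field K] (n : ℕ)

lemma finite_truncSet (c x : ℤ) : (truncSet n c x).Finite := by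
  by_cases h : c ≤ x
  · have : truncSet n c x = {t | Finsupp.degree t ≤ (x - c).toNat} := by
      ext t
      simp only [truncSet, Set.mem_ofPred_eq]
      omega
    rw [this]
    have : Finite {t : Fin n →₀ ℕ // Finsupp.degree t ≤ (x - c).toNat} :=
      .of_equiv _ ((finsuppDegreeLeEquiv n (x - c).toNat).trans
        (Sym.equivNatSumOfFintype (Fin (n + 1)) (x - c).toNat).symm).symm
    exact this
  · have : truncSet n c x = ∅ := by
      ext t
      simp only [truncSet, Set.mem_ofPred_eq, Set.mem_empty_iff_false, iff_false]
      omega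
    rw [this]
    exact Set.finite_empty

instance finite_restrictSupport_truncSet (c x : ℤ) :
    Module.Finite K (restrictSupport K (truncSet n c x)) := by
  have : Finite (truncSet n c x) := finite_truncSet n c x
  exact .of_basis (basisRestrictSupport K (truncSet n c x))

lemma finrank_restrictSupport_truncSet (c x : ℤ) (h : c ≤ x) :
    Module.finrank K (restrictSupport K (truncSet n c x)) = ((x - c).toNat + n).choose n := by
  have : Finite (truncSet n c x) := finite_truncSet n c x
  rw [Module.finrank_eq_nat_card_basis (basisRestrictSupport K (truncSet n c x)),
    ← card_finsupp_degree_le]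
  refine Nat.card_congr (Equiv.subtypeEquivRight fun t => ?_)
  change c + _ ≤ x ↔ _
  omega

lemma restrictSupport_truncSet_eq_bot (c x : ℤ) (h : x < c) :
    restrictSupport K (truncSet n c x) = ⊥ := by
  have : truncSet n c x = ∅ := by
    ext t
    simp only [truncSet, Set.mem_ofPred_eq, Set.mem_empty_iff_false, iff_false]
    omega
  rw [this, restrictSupport_eq_span]
  simp

variable {r : ℕ}

/-- The elements of `⨁_a S(-c_a)` of degree at most `x`, componentwise. -/
def freePartEquiv (c : Fin r → ℤ) (x : ℤ) :
    freePart K n c x ≃ₗ[K] ∀ a, restrictSupport K (truncSet n (c a) x) where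
  toFun v a := ⟨v.1 a, mem_freePart.1 v.2 a⟩
  invFun v := ⟨fun a => (v a).1, mem_freePart.2 fun a => (v a).2⟩
  map_add' _ _ := rfl
  map_smul' _ _ := rfl
  left_inv _ := rfl
  right_inv _ := rfl

instance finite_freePart (c : Fin r → ℤ) (x : ℤ) : Module.Finite K (freePart K n c x) :=
  .equiv (freePartEquiv K n c x).symm

lemma finrank_freePart (c : Fin r → ℤ) (x : ℤ) (h : ∀ a, c a ≤ x) :
    Module.finrank K (freePart K n c x) = ∑ a, ((x - c a).toNat + n).choose n := by
  rw [(freePartEquiv K n c x).finrank_eq, Module.finrank_pi_fintype]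
  exact Finset.sum_congr rfl fun a _ => finrank_restrictSupport_truncSet K n _ _ (h a)

lemma freePart_eq_bot (c : Fin r → ℤ) (x : ℤ) (h : ∀ a, x < c a) : freePart K n c x = ⊥ := by
  rw [eq_bot_iff]
  intro v hv
  rw [Submodule.mem_bot]
  funext a
  have := mem_freePart.1 hv a
  rwa [restrictSupport_truncSet_eq_bot K n _ _ (h a), Submodule.mem_bot] at this

end Counting

/-! ### The Hilbert function as an Euler characteristic -/

section Hilbert

universe u

variable {K : Type u} [Field K] {n : ℕ} {N : Type u} [AddCommGroup N] [Module K N]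
  [Module (MvPolynomial (Fin n) K) N] {𝒩 : Grading K n N} (F : MinimalResolution 𝒩)

/-- The boundaries of degree at most `x` in a resolution. -/
def MinimalResolution.boundaries (i : ℕ) (x : ℤ) :
    Submodule K (Fin (F.rank i) → MvPolynomial (Fin n) K) :=
  (freePart K n (F.shift (i + 1)) x).map ((F.diff i).restrictScalars K)

lemma finrank_map_add_finrank_of_ker_inf {V W : Type*} [AddCommGroup V] [Module K V]
    [AddCommGroup W] [Module K W] (f : V →ₗ[K] W) (p q : Submodule K V) [Module.Finite K p]
    (hq : LinearMap.ker f ⊓ p = q) :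
    Module.finrank K (p.map f) + Module.finrank K q = Module.finrank K p := by
  have h := (f.domRestrict p).finrank_range_add_finrank_ker
  rw [LinearMap.range_domRestrict] at h
  have e : LinearMap.ker (f.domRestrict p) ≃ₗ[K] q := by
    have hker : LinearMap.ker (f.domRestrict p) = Submodule.comap p.subtype q := by
      ext v
      simp [← hq]
    rw [hker]
    exact Submodule.comapSubtypeEquivOfLe (hq ▸ inf_le_right)
  rw [← e.finrank_eq]
  exact h

/-- Rank–nullity for the differential in degrees at most x. A cycle of degree at most x is the
boundary of the truncation of any of its preimages. -/
lemma MinimalResolution.finrank_boundaries_add (i : ℕ) (x : ℤ) :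
    Module.finrank K (F.boundaries i x) + Module.finrank K (F.boundaries (i + 1) x) =
      Module.finrank K (freePart K n (F.shift (i + 1)) x) := by
  refine finrank_map_add_finrank_of_ker_inf _ _ _ (le_antisymm ?_ ?_)
  · rintro v ⟨hv, hvx⟩
    obtain ⟨w, hw⟩ := (F.exact_diff i v).1 hv
    refine ⟨freeTrunc (F.shift (i + 2)) x w, freeTrunc_mem _ _ _, ?_⟩
    rw [LinearMap.restrictScalars_apply, ← F.diff_trunc, hw, freeTrunc_eq_self hvx]
  · rintro _ ⟨w, hw, rfl⟩
    refine ⟨(F.exact_diff i _).2 ⟨w, rfl⟩, ?_⟩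
    rw [LinearMap.restrictScalars_apply, ← freeTrunc_eq_self hw, ← F.diff_trunc]
    exact freeTrunc_mem _ _ _

variable [IsScalarTower K (MvPolynomial (Fin n) K) N]

/-- The elements of degree at most `x` of a resolved module. -/
def MinimalResolution.target (x : ℤ) : Submodule K N :=
  (freePart K n (F.shift 0) x).map (F.aug.restrictScalars K)

instance (x : ℤ) : Module.Finite K (F.target x) :=
  Module.Finite.map _ _

lemma MinimalResolution.finrank_target_add (x : ℤ) :
    Module.finrank K (F.target x) + Module.finrank K (F.boundaries 0 x) =
      Module.finrank K (freePart K n (F.shift 0) x) := by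
  refine finrank_map_add_finrank_of_ker_inf _ _ _ (le_antisymm ?_ ?_)
  · rintro v ⟨hv, hvx⟩
    obtain ⟨w, hw⟩ := (F.exact_aug v).1 hv
    refine ⟨freeTrunc (F.shift 1) x w, freeTrunc_mem _ _ _, ?_⟩
    rw [LinearMap.restrictScalars_apply, ← F.diff_trunc, hw, freeTrunc_eq_self hvx]
  · rintro _ ⟨w, hw, rfl⟩
    refine ⟨(F.exact_aug _).2 ⟨w, rfl⟩, ?_⟩
    rw [LinearMap.restrictScalars_apply, ← freeTrunc_eq_self hw, ← F.diff_trunc]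
    exact freeTrunc_mem _ _ _

lemma MinimalResolution.finrank_target (s : ℕ) (hs : ∀ i, s < i → F.rank i = 0) (x : ℤ) :
    (Module.finrank K (F.target x) : ℤ) =
      ∑ i ∈ Finset.range (s + 1), (-1) ^ i * (Module.finrank K (freePart K n (F.shift i) x) : ℤ) := by
  -- The partial Euler characteristic with its error term, the rank of the next boundaries; at k = s
  -- the error vanishes because F_{s+1} = 0.
  have key : ∀ k, (Module.finrank K (F.target x) : ℤ) =
      ∑ i ∈ Finset.range (k + 1),
        (-1) ^ i * (Module.finrank K (freePart K n (F.shift i) x) : ℤ) +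
          (-1) ^ (k + 1) * Module.finrank K (F.boundaries k x) := by
    intro k
    induction k with
    | zero =>
      rw [Finset.sum_range_one, ← F.finrank_target_add]
      push_cast
      ring
    | succ k ih =>
      rw [ih, Finset.sum_range_succ _ (k + 1), ← F.finrank_boundaries_add k x]
      push_cast
      ring
  rw [key s]
  have : IsEmpty (Fin (F.rank (s + 1))) := by
    rw [hs (s + 1) (by omega)]
    infer_instance
  have h0 : F.boundaries s x = ⊥ := by
    rw [eq_bot_iff]
    rintro _ ⟨w, -, rfl⟩
    rw [Subsingleton.elim w 0, map_zero]
    exact Submodule.zero_mem _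
  rw [h0, finrank_bot]
  simp

/-- Truncation commutes with the augmentation, so the image of the low-degree part of F_0 is the
low-degree part of N, a description free of the resolution. -/
lemma MinimalResolution.mem_target_iff (x : ℤ) (v : N) : v ∈ F.target x ↔ 𝒩.trunc x v = v := by
  constructor
  · rintro ⟨w, hw, rfl⟩
    rw [LinearMap.restrictScalars_apply, F.aug_trunc, freeTrunc_eq_self hw]
  · intro h
    obtain ⟨w, rfl⟩ := F.aug_surjective v
    rw [← h, F.aug_trunc]
    exact ⟨_, freeTrunc_mem _ _ _, rfl⟩

lemma MinimalResolution.piece_le_target (j x : ℤ) (hjx : j ≤ x) : 𝒩.piece j ≤ F.target x :=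
  fun v hv => (F.mem_target_iff x v).2 (by rw [𝒩.trunc_of_mem x j hv, if_pos hjx])

lemma MinimalResolution.target_eq_bot (x : ℤ) (h : ∀ a, x < F.shift 0 a) : F.target x = ⊥ := by
  rw [MinimalResolution.target, freePart_eq_bot K n _ _ h, Submodule.map_bot]

lemma MinimalResolution.target_add_one (x : ℤ) :
    F.target (x + 1) = F.target x ⊔ 𝒩.piece (x + 1) := by
  apply le_antisymm
  · have h : ∀ v : N, 𝒩.trunc (x + 1) v ∈ F.target x ⊔ 𝒩.piece (x + 1) := by
      intro v
      have hv : v ∈ ⨆ j, 𝒩.piece j := by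
        rw [𝒩.isInternal.submodule_iSup_eq_top]
        trivial
      induction hv using Submodule.iSup_induction' with
      | mem j v hv =>
        rw [𝒩.trunc_of_mem _ j hv]
        split_ifs with hj
        · rcases eq_or_lt_of_le hj with rfl | hj
          · exact Submodule.mem_sup_right hv
          · exact Submodule.mem_sup_left (F.piece_le_target j x (by omega) hv)
        · exact Submodule.zero_mem _
      | zero => simp
      | add v w _ _ hv hw =>
        rw [map_add]
        exact Submodule.add_mem _ hv hw
    intro v hv
    rw [F.mem_target_iff] at hv
    rw [← hv]
    exact h v
  · refine sup_le (Submodule.map_mono fun v hv => ?_) (F.piece_le_target _ _ le_rfl)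
    exact mem_freePart.2 fun a t ht => by
      have : _ ≤ x := mem_freePart.1 hv a ht
      change _ ≤ x + 1
      omega

lemma MinimalResolution.disjoint_target (x : ℤ) : Disjoint (F.target x) (𝒩.piece (x + 1)) := by
  rw [Submodule.disjoint_def]
  intro v hv hv'
  rw [F.mem_target_iff, 𝒩.trunc_of_mem x _ hv', if_neg (by omega)] at hv
  exact hv.symm

lemma MinimalResolution.hilbertFunction_eq (x : ℤ) :
    𝒩.hilbertFunction x = Module.finrank K (F.target x) := by
  -- N vanishes up to the degree `lo`, below all generators. Hence the `finsum`, which would default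
  -- to 0 on infinite support, is the sum over the finite interval (lo, x].
  obtain ⟨lo, hlo⟩ : ∃ lo : ℤ, ∀ a, lo < F.shift 0 a := by
    obtain ⟨lo, hlo⟩ := (Set.finite_range (F.shift 0)).bddBelow
    exact ⟨lo - 1, fun a => by have := hlo ⟨a, rfl⟩; omega⟩
  have hbot : ∀ j ≤ lo, F.target j = ⊥ := fun j hj =>
    F.target_eq_bot j fun a => hj.trans_lt (hlo a)
  have hzero : ∀ j ≤ lo, Module.finrank K (𝒩.piece j) = 0 := by
    intro j hj
    have : 𝒩.piece j = ⊥ := by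
      rw [eq_bot_iff, ← hbot j hj]
      exact F.piece_le_target j j le_rfl
    rw [this, finrank_bot]
  have hsum : 𝒩.hilbertFunction x = ∑ j ∈ Finset.Ioc lo x, Module.finrank K (𝒩.piece j) := by
    refine finsum_cond_eq_sum_of_cond_iff _ fun {j} hj => ?_
    rw [Finset.mem_Ioc]
    exact ⟨fun h => ⟨not_le.1 fun h' => hj (hzero j h'), h⟩, fun h => h.2⟩
  rw [hsum]
  clear hsum
  rcases le_total x lo with hx | hx
  · rw [hbot x hx, finrank_bot, Finset.Ioc_eq_empty (by omega), Finset.sum_empty]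
  · induction x, hx using Int.leInduction with
    | base => rw [hbot lo le_rfl, finrank_bot, Finset.Ioc_self, Finset.sum_empty]
    | succ x hx ih =>
      have : Finset.Ioc lo (x + 1) = insert (x + 1) (Finset.Ioc lo x) := by
        ext j
        simp only [Finset.mem_Ioc, Finset.mem_insert]
        omega
      have hfin : Module.Finite K (𝒩.piece (x + 1)) :=
        Submodule.finiteDimensional_of_le (F.piece_le_target _ _ le_rfl)
      have h := Submodule.finrank_sup_add_finrank_inf_eq (F.target x) (𝒩.piece (x + 1))
      rw [(F.disjoint_target x).eq_bot, finrank_bot, add_zero] at h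
      rw [this, Finset.sum_insert (by simp), ih, F.target_add_one, h, add_comm]

end Hilbert

/-! ### Hilbert coefficients from the shifts -/

section HilbertPolynomial

universe u

variable {K : Type u} [Field K] {n : ℕ} {N : Type u} [AddCommGroup N] [Module K N]
  [Module (MvPolynomial (Fin n) K) N] {𝒩 : Grading K n N} (F : MinimalResolution 𝒩)

/-- The alternating sum `∑_{i ≤ s} (-1)^i ∑_a binom(c_{i,a}, k)` over the shifts `c_{i,a}` of a
resolution. -/
def MinimalResolution.altSum (s k : ℕ) : ℤ :=
  ∑ i ∈ Finset.range (s + 1), (-1) ^ i * ∑ a, Ring.choose (F.shift i a) k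

/-- The Hilbert function of a module with a finite resolution. -/
lemma MinimalResolution.eventually_hilbertFunction_eq [IsScalarTower K (MvPolynomial (Fin n) K) N]
    (s : ℕ) (hs : ∀ i, s < i → F.rank i = 0) :
    ∀ᶠ x : ℕ in Filter.atTop, (𝒩.hilbertFunction x : ℤ) =
      ∑ k ∈ Finset.range (n + 1),
        (-1) ^ k * F.altSum s k * ((x + (n - k)).choose (n - k) : ℤ) := by
  have hb : ∀ᶠ x : ℕ in Filter.atTop, ∀ i ∈ Finset.range (s + 1), ∀ a, F.shift i a ≤ x := by
    rw [Filter.eventually_all_finset]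
    intro i _
    rw [Filter.eventually_all]
    intro a
    filter_upwards [Filter.eventually_ge_atTop (F.shift i a).toNat] with x hx
    omega
  filter_upwards [hb] with x hx
  rw [F.hilbertFunction_eq, F.finrank_target s hs]
  have h1 : ∀ i ∈ Finset.range (s + 1),
      (-1 : ℤ) ^ i * (Module.finrank K (freePart K n (F.shift i) x) : ℤ) =
      ∑ k ∈ Finset.range (n + 1), (-1) ^ i * (∑ a, (-1) ^ k * Ring.choose (F.shift i a) k *
        ((x + (n - k)).choose (n - k) : ℤ)) := by
    intro i hi
    rw [finrank_freePart K n _ _ (hx i hi), ← Finset.mul_sum, Finset.sum_comm]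
    push_cast
    congr 1
    exact Finset.sum_congr rfl fun a _ => choose_sub_add_eq_sum n x _ (hx i hi a)
  rw [Finset.sum_congr rfl h1, Finset.sum_comm]
  refine Finset.sum_congr rfl fun k _ => ?_
  unfold MinimalResolution.altSum
  rw [Finset.mul_sum, Finset.sum_mul]
  refine Finset.sum_congr rfl fun i _ => ?_
  simp only [Finset.mul_sum, Finset.sum_mul]
  exact Finset.sum_congr rfl fun a _ => by ring

/-- For k < s the polynomial binom(x + n - k, n - k) has degree at least n - s + 1, so the growth
hypothesis rules out its coefficient. -/
lemma MinimalResolution.altSum_eq_zero [IsScalarTower K (MvPolynomial (Fin n) K) N]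
    (s : ℕ) (hs : ∀ i, s < i → F.rank i = 0) (hsn : s ≤ n)
    (hgrowth : Filter.Tendsto (fun x : ℕ => (𝒩.hilbertFunction x : ℝ) / (x : ℝ) ^ (n - s + 1))
      Filter.atTop (nhds 0)) (k : ℕ) (hk : k < s) : F.altSum s k = 0 := by
  have h := coeff_eq_zero_of_tendsto (n + 1) (n - s + 1)
    (fun j => (((-1) ^ (n - j) * F.altSum s (n - j) : ℤ) : ℝ)) (hgrowth.congr' ?_) (n - k)
    (by omega) (by omega)
  · have h2 : (-1 : ℤ) ^ (n - (n - k)) * F.altSum s (n - (n - k)) = 0 := by exact_mod_cast h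
    rw [show n - (n - k) = k by omega] at h2
    simpa using h2
  · filter_upwards [F.eventually_hilbertFunction_eq s hs] with x hx
    congr 1
    rw [← Finset.sum_range_reflect]
    have := congrArg (Int.cast (R := ℝ)) hx
    push_cast at this ⊢
    rw [this]
    refine Finset.sum_congr rfl fun k hk => ?_
    have hk' : k ≤ n := by simpa [Nat.lt_succ_iff] using hk
    rw [show n - (n - k) = k by omega]

lemma Grading.isHilbertCoefficients_unique {d : ℕ} {e e' : Fin (d + 1) → ℤ}
    (he : 𝒩.IsHilbertCoefficients e) (he' : 𝒩.IsHilbertCoefficients e') : e = e' := by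
  let b : ℕ → ℝ := fun j => if h : d - j < d + 1 then
    (((-1) ^ (d - j) * (e ⟨d - j, h⟩ - e' ⟨d - j, h⟩) : ℤ) : ℝ) else 0
  -- The difference of the two expansions is eventually 0, so the exponent D = 0 is allowed and
  -- every coefficient vanishes.
  have h := coeff_eq_zero_of_tendsto (d + 1) 0 b ?_
  · funext i
    have h2 := h (d - i) (by omega) (Nat.zero_le _)
    have h3 : d - (d - (i : ℕ)) = i := by omega
    simp only [b, h3, Fin.is_lt, dif_pos, Fin.eta] at h2
    have h4 : (-1 : ℤ) ^ (i : ℕ) * (e i - e' i) = 0 := by exact_mod_cast h2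
    have h5 : e i - e' i = 0 := by simpa using h4
    omega
  · refine tendsto_const_nhds.congr' ?_
    filter_upwards [he, he'] with x hx hx'
    rw [hx, ← sub_eq_zero, ← Finset.sum_sub_distrib] at hx'
    rw [pow_zero, div_one, ← Finset.sum_range_reflect, Finset.sum_range]
    have := congrArg (Int.cast (R := ℝ)) hx'
    rw [Int.cast_zero] at this
    rw [← this, Int.cast_sum]
    refine Finset.sum_congr rfl fun i _ => ?_
    have h3 : d - (d - (i : ℕ)) = i := by omega
    have h4 : d + 1 - 1 - (i : ℕ) = d - i := by omega
    simp only [b, h4, h3, Fin.is_lt, dif_pos, Fin.eta]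
    push_cast
    ring

/-- The Hilbert coefficients of a module of codimension `s` in terms of a resolution. -/
lemma MinimalResolution.isHilbertCoefficients [IsScalarTower K (MvPolynomial (Fin n) K) N]
    (s : ℕ) (hs : ∀ i, s < i → F.rank i = 0) (hsn : s ≤ n)
    (hzero : ∀ k < s, F.altSum s k = 0) :
    𝒩.IsHilbertCoefficients (d := n - s) fun i => (-1) ^ s * F.altSum s (s + i) := by
  unfold Grading.IsHilbertCoefficients
  filter_upwards [F.eventually_hilbertFunction_eq s hs] with x hx
  rw [hx, show n + 1 = s + (n - s + 1) by omega, Finset.sum_range_add,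
    Finset.sum_eq_zero (s := Finset.range s) fun k hk => by
      rw [hzero k (Finset.mem_range.1 hk)]; ring, zero_add, Finset.sum_range]
  refine Finset.sum_congr rfl fun i _ => ?_
  rw [show n - (s + (i : ℕ)) = n - s - i by omega, pow_add]
  ring

end HilbertPolynomial

/-! ### Growth of the Hilbert function -/

/-- Lying over provides a prime above the head of a chain, and going up lifts the rest, so every
chain of primes of R lifts to one of the same length in A. -/
lemma ringKrullDim_le_of_isIntegral {R A : Type*} [CommRing R] [CommRing A] [Algebra R A]
    [Algebra.IsIntegral R A] (hinj : Function.Injective (algebraMap R A)) :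
    ringKrullDim R ≤ ringKrullDim A := by
  refine iSup_le fun l => ?_
  obtain ⟨Q, -, hQ, hQl⟩ := Ideal.exists_ideal_over_prime_of_isIntegral (S := A)
    (RelSeries.head l).asIdeal ⊥ (by
      rw [← RingHom.ker_eq_comap_bot, (RingHom.injective_iff_ker_eq_bot _).1 hinj]
      exact bot_le)
  have : Q.LiesOver (RelSeries.head l).asIdeal := ⟨hQl.symm⟩
  obtain ⟨L, hL, -⟩ := Ideal.exists_ltSeries_of_hasGoingUp l Q
  rw [← hL]
  exact le_iSup (fun L : LTSeries (PrimeSpectrum A) => (L.length : WithBot ℕ∞)) L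

section Growth

universe u

variable {K : Type u} [Field K] {n : ℕ}

lemma mul_mem_restrictSupport_truncSet {p q : MvPolynomial (Fin n) K} {c d : ℤ}
    (hp : p ∈ restrictSupport K (truncSet n 0 c)) (hq : q ∈ restrictSupport K (truncSet n 0 d)) :
    p * q ∈ restrictSupport K (truncSet n 0 (c + d)) := by
  classical
  open scoped Pointwise in
  have h := Submodule.mul_mem_mul hp hq
  rw [← restrictSupport_add] at h
  refine restrictSupport_mono K ?_ h
  rintro _ ⟨t, ht, t', ht', rfl⟩
  simp only [truncSet, Set.mem_ofPred_eq, map_add] at ht ht' ⊢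
  push_cast
  omega

lemma restrictSupport_truncSet_mono {c d : ℤ} (h : c ≤ d) :
    restrictSupport K (truncSet n 0 c) ≤ restrictSupport K (truncSet n 0 d) := by
  refine restrictSupport_mono K fun t ht => ?_
  simp only [truncSet, Set.mem_ofPred_eq] at ht ⊢
  omega

lemma exists_mem_restrictSupport_truncSet (p : MvPolynomial (Fin n) K) :
    ∃ D : ℕ, p ∈ restrictSupport K (truncSet n 0 D) := by
  refine ⟨p.support.sup Finsupp.degree, fun t ht => ?_⟩
  have := Finset.le_sup (f := Finsupp.degree) (Finset.mem_coe.1 ht)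
  simp only [truncSet, Set.mem_ofPred_eq, zero_add]
  exact_mod_cast this

variable {N : Type u} [AddCommGroup N] [Module K N] [Module (MvPolynomial (Fin n) K) N]
  [IsScalarTower K (MvPolynomial (Fin n) K) N] {e r : ℕ}

/-- The map `R^r → N` attached to `r` elements of an `S`-module `N` and a homomorphism `R → S`
of polynomial rings. -/
def combination (φ : MvPolynomial (Fin e) K →ₐ[K] MvPolynomial (Fin n) K) (G : Fin r → N) :
    (Fin r → MvPolynomial (Fin e) K) →ₗ[K] N where
  toFun q := ∑ k, φ (q k) • G k
  map_add' q q' := by simp [add_smul, Finset.sum_add_distrib]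
  map_smul' c q := by simp [Finset.smul_sum]

/-- The combinations of the elements `G_k` with coefficients of degree at most `D`. -/
def filtration (φ : MvPolynomial (Fin e) K →ₐ[K] MvPolynomial (Fin n) K) (G : Fin r → N) (D : ℕ) :
    Submodule K N :=
  (freePart K e (0 : Fin r → ℤ) D).map (combination φ G)

variable (φ : MvPolynomial (Fin e) K →ₐ[K] MvPolynomial (Fin n) K) (G : Fin r → N)

instance (D : ℕ) : Module.Finite K (filtration φ G D) := Module.Finite.map _ _

lemma finrank_filtration_le (D : ℕ) :
    Module.finrank K (filtration φ G D) ≤ r * (D + e) ^ e := by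
  refine (Submodule.finrank_map_le _ _).trans ?_
  rw [finrank_freePart K e _ _ fun a => by simp]
  simp only [Pi.zero_apply, sub_zero, Int.toNat_natCast, Finset.sum_const, Finset.card_univ,
    Fintype.card_fin, smul_eq_mul]
  exact Nat.mul_le_mul_left _ (Nat.choose_le_pow _ _)

lemma filtration_mono {D D' : ℕ} (h : D ≤ D') : filtration φ G D ≤ filtration φ G D' := by
  refine Submodule.map_mono fun v hv => mem_freePart.2 fun a => ?_
  exact restrictSupport_truncSet_mono (by exact_mod_cast h) (mem_freePart.1 hv a)

lemma exists_mem_filtration (hG : Function.Surjective (combination φ G)) (v : N) :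
    ∃ D, v ∈ filtration φ G D := by
  obtain ⟨q, rfl⟩ := hG v
  choose D hD using fun k => exists_mem_restrictSupport_truncSet (q k)
  refine ⟨Finset.univ.sup D, q, mem_freePart.2 fun k => ?_, rfl⟩
  exact restrictSupport_truncSet_mono
    (by exact_mod_cast Finset.le_sup (f := D) (Finset.mem_univ k)) (hD k)

lemma exists_forall_mem_filtration {ι : Type*} [Finite ι]
    (hG : Function.Surjective (combination φ G)) (v : ι → N) :
    ∃ D, ∀ i, v i ∈ filtration φ G D := by
  have := Fintype.ofFinite ι
  choose D hD using fun i => exists_mem_filtration φ G hG (v i)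
  exact ⟨Finset.univ.sup D, fun i =>
    filtration_mono φ G (Finset.le_sup (f := D) (Finset.mem_univ i)) (hD i)⟩

lemma smul_mem_filtration {D c : ℕ} {q : MvPolynomial (Fin e) K}
    (hq : q ∈ restrictSupport K (truncSet e 0 D)) {v : N} (hv : v ∈ filtration φ G c) :
    φ q • v ∈ filtration φ G (D + c) := by
  obtain ⟨w, hw, rfl⟩ := hv
  refine ⟨fun k => q * w k, mem_freePart.2 fun k => ?_, ?_⟩
  · push_cast
    exact mul_mem_restrictSupport_truncSet hq (mem_freePart.1 hw k)
  · simp [combination, Finset.smul_sum, mul_smul]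

lemma X_smul_mem_filtration {c : ℕ}
    (hc : ∀ (i : Fin n) k, (X i : MvPolynomial (Fin n) K) • G k ∈ filtration φ G c)
    (i : Fin n) {D : ℕ} {v : N} (hv : v ∈ filtration φ G D) :
    (X i : MvPolynomial (Fin n) K) • v ∈ filtration φ G (D + c) := by
  obtain ⟨w, hw, rfl⟩ := hv
  have h : (X i : MvPolynomial (Fin n) K) • combination φ G w =
      ∑ k, φ (w k) • (X i : MvPolynomial (Fin n) K) • G k := by
    simp only [combination, LinearMap.coe_mk, AddHom.coe_mk, Finset.smul_sum]
    exact Finset.sum_congr rfl fun k _ => smul_comm _ _ _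
  rw [h]
  exact Submodule.sum_mem _ fun k _ => smul_mem_filtration φ G (mem_freePart.1 hw k) (hc i k)

/-- Each variable raises the filtration level by at most c. -/
lemma monomial_smul_mem_filtration {c : ℕ}
    (hc : ∀ (i : Fin n) k, (X i : MvPolynomial (Fin n) K) • G k ∈ filtration φ G c)
    {v : N} (hv : v ∈ filtration φ G c) (m : ℕ) (t : Fin n →₀ ℕ) (ht : Finsupp.degree t = m) :
    (monomial t (1 : K)) • v ∈ filtration φ G (c * (m + 1)) := by
  induction m generalizing t with
  | zero =>
    have : t = 0 := (Finsupp.degree_eq_zero_iff t).1 ht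
    subst this
    simpa using hv
  | succ m ih =>
    have hne : t ≠ 0 := by
      rintro rfl
      simp at ht
    obtain ⟨i, hi⟩ := Finsupp.ne_iff.1 hne
    have hle : Finsupp.single i 1 ≤ t := by
      rw [Finsupp.single_le_iff]
      exact Nat.one_le_iff_ne_zero.2 hi
    have hadd : t = Finsupp.single i 1 + (t - Finsupp.single i 1) :=
      (add_tsub_cancel_of_le hle).symm
    have hdeg : Finsupp.degree (t - Finsupp.single i 1) = m := by
      rw [hadd, map_add, Finsupp.degree_single] at ht
      omega
    have hmul : monomial t (1 : K) = X i * monomial (t - Finsupp.single i 1) 1 := by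
      rw [X, monomial_mul, ← hadd, one_mul]
    rw [hmul, mul_smul]
    have := X_smul_mem_filtration φ G hc i (ih _ hdeg)
    rwa [show c * (m + 1) + c = c * (m + 1 + 1) by ring] at this

variable {𝒩 : Grading K n N}

/-- The map φ need not respect degrees, so grading and filtration are only compared up to a linear
change of the degree, which does not affect the order of growth. -/
lemma MinimalResolution.exists_target_le_filtration (F : MinimalResolution 𝒩)
    (hG : Function.Surjective (combination φ G)) :
    ∃ c b : ℕ, ∀ x : ℕ, F.target x ≤ filtration φ G (c * (x + b)) := by
  obtain ⟨c₁, hc₁⟩ := exists_forall_mem_filtration φ G hG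
    fun p : Fin n × Fin r => (X p.1 : MvPolynomial (Fin n) K) • G p.2
  obtain ⟨c₂, hc₂⟩ := exists_forall_mem_filtration φ G hG
    fun a : Fin (F.rank 0) => F.aug (Pi.single a 1)
  obtain ⟨lo, hlo⟩ : ∃ lo : ℕ, ∀ a, -(lo : ℤ) ≤ F.shift 0 a := by
    obtain ⟨lo, hlo⟩ := (Set.finite_range (F.shift 0)).bddBelow
    exact ⟨lo.natAbs, fun a => by have := hlo ⟨a, rfl⟩; omega⟩
  set c := max c₁ c₂
  have hc : ∀ (i : Fin n) k, (X i : MvPolynomial (Fin n) K) • G k ∈ filtration φ G c :=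
    fun i k => filtration_mono φ G (le_max_left _ _) (hc₁ (i, k))
  have hc' : ∀ a, F.aug (Pi.single a 1) ∈ filtration φ G c :=
    fun a => filtration_mono φ G (le_max_right _ _) (hc₂ a)
  -- A monomial coefficient in total degree at most x has polynomial degree at most x + lo; the
  -- extra 1 is the level c of the generator itself.
  refine ⟨c, lo + 1, fun x => ?_⟩
  rintro _ ⟨w, hw, rfl⟩
  have hw' : w = ∑ a, Pi.single a (w a) := (Finset.univ_sum_single w).symm
  rw [LinearMap.restrictScalars_apply, hw', map_sum]
  refine Submodule.sum_mem _ fun a _ => ?_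
  rw [(w a).as_sum, ← LinearMap.single_apply (R := MvPolynomial (Fin n) K), map_sum, map_sum]
  refine Submodule.sum_mem _ fun t ht => ?_
  rw [LinearMap.single_apply]
  have h : Pi.single a (monomial t (coeff t (w a))) = coeff t (w a) •
      (monomial t (1 : K)) • (Pi.single a 1 : Fin (F.rank 0) → MvPolynomial (Fin n) K) := by
    rw [← Pi.single_smul, ← Pi.single_smul, smul_eq_mul, mul_one, smul_monomial, smul_eq_mul, mul_one]
  have hdeg : F.shift 0 a + (Finsupp.degree t : ℕ) ≤ x := mem_freePart.1 hw a ht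
  have := hlo a
  rw [h, ← LinearMap.restrictScalars_apply K, map_smul, LinearMap.restrictScalars_apply, map_smul]
  refine Submodule.smul_mem _ _ (filtration_mono φ G ?_
    (monomial_smul_mem_filtration φ G hc (hc' a) _ t rfl))
  exact Nat.mul_le_mul_left _ (by omega)

/-- A module that is finite over a polynomial ring in `e` variables has a Hilbert function of
growth at most `x ^ e`. -/
lemma MinimalResolution.tendsto_hilbertFunction_div (F : MinimalResolution 𝒩)
    (hG : Function.Surjective (combination φ G)) (d : ℕ) (hed : e ≤ d) :
    Filter.Tendsto (fun x : ℕ => (𝒩.hilbertFunction x : ℝ) / (x : ℝ) ^ (d + 1))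
      Filter.atTop (nhds 0) := by
  obtain ⟨c, b, h⟩ := F.exists_target_le_filtration φ G hG
  -- The constant comes from c(x + b) + e ≤ (c(1 + b) + e)x for x ≥ 1.
  refine squeeze_zero' (g := fun x : ℕ => ((r * (c * (1 + b) + e) ^ e : ℕ) : ℝ) / (x : ℝ)) ?_ ?_
    (tendsto_const_div_atTop_nhds_zero_nat _)
  · exact Filter.Eventually.of_forall fun x => by positivity
  · filter_upwards [Filter.eventually_ge_atTop 1] with x hx
    have h1 : 𝒩.hilbertFunction x ≤ r * (c * (1 + b) + e) ^ e * x ^ d := by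
      rw [F.hilbertFunction_eq]
      refine (Submodule.finrank_mono (h x)).trans ((finrank_filtration_le φ G _).trans ?_)
      rw [mul_assoc]
      refine Nat.mul_le_mul_left _ ?_
      calc (c * (x + b) + e) ^ e ≤ ((c * (1 + b) + e) * x) ^ e := by
            refine Nat.pow_le_pow_left ?_ _
            nlinarith [Nat.zero_le (c * b), Nat.zero_le e, Nat.mul_le_mul_left (c * b) hx,
              Nat.mul_le_mul_left e hx]
        _ = (c * (1 + b) + e) ^ e * x ^ e := mul_pow _ _ _
        _ ≤ _ := Nat.mul_le_mul_left _ (Nat.pow_le_pow_right hx hed)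
    have hx' : (0 : ℝ) < x := by exact_mod_cast hx
    rw [div_le_div_iff₀ (by positivity) hx', pow_succ, ← mul_assoc]
    have : (𝒩.hilbertFunction x : ℝ) ≤ ((r * (c * (1 + b) + e) ^ e : ℕ) : ℝ) * (x : ℝ) ^ d := by
      exact_mod_cast h1
    gcongr

end Growth

/-- Noether normalization, with the number of variables bounded by the Krull dimension. -/
lemma exists_algHom_finite_of_finiteType (K A : Type*) [Field K] [CommRing A] [Nontrivial A]
    [Algebra K A] [Algebra.FiniteType K A] :
    ∃ (e m : ℕ) (g : MvPolynomial (Fin e) K →ₐ[K] A) (α : Fin m → A),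
      (e : WithBot ℕ∞) ≤ ringKrullDim A ∧
        ∀ x, ∃ q : Fin m → MvPolynomial (Fin e) K, ∑ l, g (q l) * α l = x := by
  obtain ⟨e, g, hinj, hfin⟩ := exists_finite_inj_algHom_of_fg K A
  let : Algebra (MvPolynomial (Fin e) K) A := g.toRingHom.toAlgebra
  have : Module.Finite (MvPolynomial (Fin e) K) A := hfin
  obtain ⟨m, α, hα⟩ := Module.Finite.exists_fin (R := MvPolynomial (Fin e) K) (M := A)
  refine ⟨e, m, g, α, ?_, fun x => ?_⟩
  · have h := ringKrullDim_le_of_isIntegral (R := MvPolynomial (Fin e) K) (A := A) hinj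
    rwa [MvPolynomial.ringKrullDim_of_isNoetherianRing, ringKrullDim_eq_zero_of_field, zero_add,
      Nat.card_fin] at h
  · obtain ⟨q, hq⟩ := (Submodule.mem_span_range_iff_exists_fun (MvPolynomial (Fin e) K)
      (v := α) (x := x)).1 (by rw [hα]; trivial)
    exact ⟨q, hq⟩

section Growth

universe u

variable {K : Type u} [Field K] {n : ℕ}
variable {N : Type u} [AddCommGroup N] [Module K N] [Module (MvPolynomial (Fin n) K) N]
  [IsScalarTower K (MvPolynomial (Fin n) K) N]

/-- A module of codimension `s` is finite over a polynomial ring in `n - s` variables. -/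
lemma exists_surjective_combination [Nontrivial N] [Module.Finite (MvPolynomial (Fin n) K) N]
    {s : ℕ} (hs : HasCodim K n N s) :
    ∃ (e r : ℕ) (φ : MvPolynomial (Fin e) K →ₐ[K] MvPolynomial (Fin n) K) (G : Fin r → N),
      e ≤ n - s ∧ Function.Surjective (combination φ G) := by
  let I := Module.annihilator (MvPolynomial (Fin n) K) N
  have hI : I ≠ ⊤ := by
    rw [Ne, Module.annihilator_eq_top_iff]
    exact not_subsingleton N
  have : Nontrivial (MvPolynomial (Fin n) K ⧸ I) := Ideal.Quotient.nontrivial_iff.2 hI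
  obtain ⟨e, m, g, α, hdim, hα⟩ :=
    exists_algHom_finite_of_finiteType K (MvPolynomial (Fin n) K ⧸ I)
  choose y hy using fun i => Ideal.Quotient.mk_surjective (I := I) (g (X i))
  -- A lift to S of the normalization g of S/I. As I annihilates N, acting through φ is the same as
  -- acting through g, and the products of module generators of S/I with generators of N generate N.
  let φ : MvPolynomial (Fin e) K →ₐ[K] MvPolynomial (Fin n) K := aeval y
  have hφ : ∀ q, Ideal.Quotient.mk I (φ q) = g q := by
    intro q
    have : (Ideal.Quotient.mkₐ K I).comp φ = g := by
      refine algHom_ext fun i => ?_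
      simp only [AlgHom.comp_apply, φ, aeval_X]
      exact hy i
    exact congrArg (fun f => f q) this
  have hdim : e ≤ n - s := by
    rw [← Module.supportDim_eq_ringKrullDim_quotient_annihilator] at hdim
    have h2 : (e : WithBot ℕ∞) + (s : WithBot ℕ∞) ≤ (n : WithBot ℕ∞) := by
      rw [← hs]
      gcongr
    have h3 : e + s ≤ n := by exact_mod_cast h2
    omega
  obtain ⟨p, G₀, hG₀⟩ := Module.Finite.exists_fin (R := MvPolynomial (Fin n) K) (M := N)
  choose α' hα' using fun l => Ideal.Quotient.mk_surjective (I := I) (α l)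
  refine ⟨e, m * p, φ, fun k => α' (finProdFinEquiv.symm k).1 • G₀ (finProdFinEquiv.symm k).2,
    hdim, fun v => ?_⟩
  have hv : v ∈ Submodule.span (MvPolynomial (Fin n) K) (Set.range G₀) := by
    rw [hG₀]
    trivial
  obtain ⟨f, rfl⟩ := (Submodule.mem_span_range_iff_exists_fun _).1 hv
  choose q hq using fun a => hα (Ideal.Quotient.mk I (f a))
  refine ⟨fun k => q (finProdFinEquiv.symm k).2 (finProdFinEquiv.symm k).1, ?_⟩
  simp only [combination, LinearMap.coe_mk, AddHom.coe_mk]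
  rw [Fintype.sum_equiv finProdFinEquiv.symm _
    (fun k : Fin m × Fin p => φ (q k.2 k.1) • α' k.1 • G₀ k.2) (fun k => rfl),
    Fintype.sum_prod_type_right]
  refine Finset.sum_congr rfl fun a _ => ?_
  have hmem : f a - ∑ l, φ (q a l) * α' l ∈ I := by
    rw [← Ideal.Quotient.eq_zero_iff_mem, map_sub, ← hq, map_sum, sub_eq_zero]
    refine Finset.sum_congr rfl fun l _ => ?_
    rw [map_mul, hφ, hα']
  have h0 := Module.mem_annihilator.1 hmem (G₀ a)
  rw [sub_smul, sub_eq_zero] at h0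
  rw [h0, Finset.sum_smul]
  exact Finset.sum_congr rfl fun l _ => (mul_smul _ _ _).symm

lemma MinimalResolution.tendsto_hilbertFunction_div_of_hasCodim [Nontrivial N]
    [Module.Finite (MvPolynomial (Fin n) K) N] {𝒩 : Grading K n N} (F : MinimalResolution 𝒩)
    {s : ℕ} (hs : HasCodim K n N s) :
    Filter.Tendsto (fun x : ℕ => (𝒩.hilbertFunction x : ℝ) / (x : ℝ) ^ (n - s + 1))
      Filter.atTop (nhds 0) := by
  obtain ⟨e, r, φ, G, he, hG⟩ := exists_surjective_combination hs
  exact F.tendsto_hilbertFunction_div φ G hG _ he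

end Growth

/-! ### Degrees of the minimal generators -/

section Generators

universe u

variable {K : Type u} [Field K] {n : ℕ}
variable {N : Type u} [AddCommGroup N] [Module K N] [Module (MvPolynomial (Fin n) K) N]

/-- Write v through elements of degree 0 and project to degree j: only the degree j parts of the
coefficients survive, and for j ≠ 0 these have no constant term. -/
lemma Grading.mem_smul_top_of_generatedInDegreeZero {𝒩 : Grading K n N}
    (h0 : 𝒩.GeneratedInDegreeZero) {j : ℤ} (hj : j ≠ 0) {v : N} (hv : v ∈ 𝒩.piece j) :
    v ∈ varIdeal K n n • (⊤ : Submodule (MvPolynomial (Fin n) K) N) := by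
  let π : N →ₗ[K] N := 𝒩.trunc j - 𝒩.trunc (j - 1)
  have hπ : ∀ (i : ℤ) (u : N), u ∈ 𝒩.piece i → π u = if i = j then u else 0 := by
    intro i u hu
    simp only [π, LinearMap.sub_apply, 𝒩.trunc_of_mem _ i hu]
    split_ifs <;> first | omega | simp
  have key : ∀ u : N, π u ∈ varIdeal K n n • (⊤ : Submodule (MvPolynomial (Fin n) K) N) := by
    intro u
    have hu : u ∈ Submodule.span (MvPolynomial (Fin n) K) (𝒩.piece 0 : Set N) := by
      rw [h0]
      trivial
    obtain ⟨m, f, g, rfl⟩ := Submodule.mem_span_set'.1 hu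
    rw [map_sum]
    refine Submodule.sum_mem _ fun k _ => ?_
    rw [(f k).as_sum, Finset.sum_smul, map_sum]
    refine Submodule.sum_mem _ fun t _ => ?_
    have hmem := 𝒩.smul_mem _ (monomial t (coeff t (f k))) 0 (g k)
      (isHomogeneous_monomial _ rfl) (g k).2
    rw [hπ _ _ hmem]
    split_ifs with h
    · refine Submodule.smul_mem_smul ((mem_varIdeal_iff K n _).2 ?_) trivial
      have ht : t ≠ 0 := by
        rintro rfl
        simp at h
        exact hj h.symm
      rw [constantCoeff_eq, coeff_monomial, if_neg ht]
    · exact Submodule.zero_mem _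
  have := key v
  rwa [hπ j v hv, if_pos rfl] at this

/-- The generators of a minimal resolution of a module generated in degree zero have degree
zero. -/
lemma MinimalResolution.shift_zero_eq_zero {𝒩 : Grading K n N} (F : MinimalResolution 𝒩)
    (h0 : 𝒩.GeneratedInDegreeZero) (a : Fin (F.rank 0)) : F.shift 0 a = 0 := by
  by_contra hj
  have h := Grading.mem_smul_top_of_generatedInDegreeZero h0 hj (F.aug_degree a)
  -- With 𝔪 the ideal of the variables, 𝔪N is the image of 𝔪F_0. So the basis vector lies in 𝔪F_0
  -- plus the image of the differential, hence in 𝔪F_0 by minimality, although its coordinate is 1.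
  rw [← LinearMap.range_eq_top.2 F.aug_surjective, ← Submodule.map_top, ← Submodule.map_smul''] at h
  obtain ⟨w, hw, hwa⟩ := h
  obtain ⟨u, hu⟩ := (F.exact_aug (Pi.single a 1 - w)).1 (by rw [map_sub, hwa, sub_self])
  have h1 := Submodule.add_mem _ (F.range_diff_le 0 ⟨u, hu⟩) hw
  rw [sub_add_cancel, mem_varIdeal_smul_top_iff] at h1
  simpa using h1 a

end Generators

/-! ### Betti diagrams -/

section Diagrams

/-- The functional `∑_{i,j} (-1)^i φ(j) β_{i,j}` on diagrams supported between `m` and `M`. -/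
def windowSum {s : ℕ} (m M : Fin (s + 1) → ℤ) (φ : ℤ → ℚ) (β : ℕ → ℤ → ℚ) : ℚ :=
  ∑ i : Fin (s + 1), ∑ j ∈ Finset.Icc (m i) (M i), (-1 : ℚ) ^ (i : ℕ) * φ j * β i j

lemma windowSum_smul {s : ℕ} (m M : Fin (s + 1) → ℤ) (φ : ℤ → ℚ) (c : ℚ) (β : ℕ → ℤ → ℚ) :
    windowSum m M φ (c • β) = c * windowSum m M φ β := by
  simp only [windowSum, Finset.mul_sum, Pi.smul_apply, smul_eq_mul]
  exact Finset.sum_congr rfl fun i _ => Finset.sum_congr rfl fun j _ => by ring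

lemma windowSum_sum {s : ℕ} (m M : Fin (s + 1) → ℤ) (φ : ℤ → ℚ) {ι : Type*} [Fintype ι]
    (β : ι → ℕ → ℤ → ℚ) : windowSum m M φ (∑ t, β t) = ∑ t, windowSum m M φ (β t) := by
  simp only [windowSum, Finset.sum_apply, Finset.mul_sum]
  rw [Finset.sum_comm]
  refine Finset.sum_congr rfl fun i _ => ?_
  rw [Finset.sum_comm]

lemma windowSum_pureDiagram {s : ℕ} (m M : Fin (s + 1) → ℤ) (φ : ℤ → ℚ) (d : Fin (s + 1) → ℤ)
    (hd : ∀ i, m i ≤ d i ∧ d i ≤ M i) :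
    windowSum m M φ (pureDiagram d) =
      ∑ i : Fin (s + 1), (-1 : ℚ) ^ (i : ℕ) * pureDiagram d i (d i) * φ (d i) := by
  unfold windowSum
  refine Finset.sum_congr rfl fun i _ => ?_
  rw [Finset.sum_eq_single (d i)]
  · ring
  · intro j _ hj
    rw [pureDiagram_apply, if_neg hj, mul_zero]
  · intro h
    exact absurd (Finset.mem_Icc.2 (hd i)) h

/-- Used to pass from binomial coefficients of the shifts to powers, one factor at a time. -/
lemma cast_mul_ringChoose (j : ℤ) (l : ℕ) :
    (j : ℚ) * (Ring.choose j l : ℤ) =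
      (l + 1) * (Ring.choose j (l + 1) : ℤ) + l * (Ring.choose j l : ℤ) := by
  rw [cast_ringChoose_eq_prod, cast_ringChoose_eq_prod, Finset.prod_range_succ,
    Nat.factorial_succ]
  have : ((l.factorial : ℕ) : ℚ) ≠ 0 := by positivity
  push_cast
  field_simp
  ring

lemma natCast_le_of_strictMono {s : ℕ} (d : Fin (s + 1) → ℤ) (hd : StrictMono d) (h0 : d 0 = 0)
    (i : Fin (s + 1)) : ((i : ℕ) : ℤ) ≤ d i := by
  induction i using Fin.induction with
  | zero => simp [h0]
  | succ i ih =>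
    have := hd (Fin.castSucc_lt_succ (i := i))
    simp only [Fin.val_castSucc, Fin.val_succ] at ih ⊢
    push_cast
    omega

lemma bound_eq_mul {s : ℕ} (b : ℚ) (i : ℕ) (d : Fin s → ℤ) : bound b i d = b * bound 1 i d := by
  unfold bound
  ring

universe u

variable {K : Type u} [Field K] {n : ℕ} {N : Type u} [AddCommGroup N] [Module K N]
  [Module (MvPolynomial (Fin n) K) N] {𝒩 : Grading K n N} (F : MinimalResolution 𝒩)

lemma MinimalResolution.diagram_ne_zero_iff (i : ℕ) (j : ℤ) :
    F.diagram i j ≠ 0 ↔ ∃ a, F.shift i a = j := by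
  simp [MinimalResolution.diagram, Finset.filter_eq_empty_iff]

lemma MinimalResolution.finite_support_diagram (i : ℕ) : {j | F.diagram i j ≠ 0}.Finite :=
  (Set.finite_range (F.shift i)).subset fun j hj => (F.diagram_ne_zero_iff i j).1 hj

lemma MinimalResolution.sum_mul_diagram (i : ℕ) (φ : ℤ → ℚ) (J : Finset ℤ)
    (hJ : ∀ a, F.shift i a ∈ J) : ∑ j ∈ J, φ j * F.diagram i j = ∑ a, φ (F.shift i a) := by
  rw [← Finset.sum_fiberwise_of_maps_to (t := J) (g := F.shift i) fun a _ => hJ a]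
  refine Finset.sum_congr rfl fun j _ => ?_
  rw [Finset.sum_congr rfl fun a ha => by rw [(Finset.mem_filter.1 ha).2], Finset.sum_const,
    nsmul_eq_mul, mul_comm]
  rfl

lemma MinimalResolution.betaZero_diagram : betaZero F.diagram = F.rank 0 := by
  unfold betaZero
  rw [finsum_eq_sum_of_support_subset (s := Finset.univ.image (F.shift 0))]
  · have := F.sum_mul_diagram 0 (fun _ => 1) (Finset.univ.image (F.shift 0)) (by simp)
    simpa using this
  · intro j hj
    obtain ⟨a, rfl⟩ := (F.diagram_ne_zero_iff 0 j).1 hj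
    simp

lemma MinimalResolution.windowSum_diagram {s : ℕ} (m M : Fin (s + 1) → ℤ) (φ : ℤ → ℚ)
    (hm : ∀ (i : Fin (s + 1)) a, m i ≤ F.shift i a ∧ F.shift i a ≤ M i) :
    windowSum m M φ F.diagram =
      ∑ i ∈ Finset.range (s + 1), (-1) ^ i * ∑ a, φ (F.shift i a) := by
  rw [Finset.sum_range]
  refine Finset.sum_congr rfl fun i _ => ?_
  rw [← F.sum_mul_diagram i φ (Finset.Icc (m i) (M i)) fun a => Finset.mem_Icc.2 (hm i a),
    Finset.mul_sum]
  exact Finset.sum_congr rfl fun j _ => by ring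

lemma MinimalResolution.cast_altSum (s k : ℕ) :
    (F.altSum s k : ℚ) = ∑ i ∈ Finset.range (s + 1),
      (-1) ^ i * ∑ a, ((Ring.choose (F.shift i a) k : ℤ) : ℚ) := by
  unfold MinimalResolution.altSum
  push_cast
  rfl

/-- The case l = 0 is the Herzog–Kühl equations defining V_{m,M}. The mixed form is needed for the
induction, since trading a power for binomial coefficients may raise l by one. -/
lemma MinimalResolution.alternating_power_sum_eq_zero {s : ℕ}
    (hzero : ∀ k < s, F.altSum s k = 0) (k l : ℕ) (hkl : k + l < s) :
    ∑ i ∈ Finset.range (s + 1), (-1 : ℚ) ^ i *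
      ∑ a, (F.shift i a : ℚ) ^ k * (Ring.choose (F.shift i a) l : ℤ) = 0 := by
  induction k generalizing l with
  | zero =>
    have := F.cast_altSum s l
    rw [hzero l (by omega), Int.cast_zero] at this
    simpa using this.symm
  | succ k ih =>
    have h1 := ih (l + 1) (by omega)
    have h2 := ih l (by omega)
    calc _ = (l + 1 : ℚ) * ∑ i ∈ Finset.range (s + 1), (-1 : ℚ) ^ i *
          ∑ a, (F.shift i a : ℚ) ^ k * (Ring.choose (F.shift i a) (l + 1) : ℤ) +
        l * ∑ i ∈ Finset.range (s + 1), (-1 : ℚ) ^ i *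
          ∑ a, (F.shift i a : ℚ) ^ k * (Ring.choose (F.shift i a) l : ℤ) := by
          simp only [Finset.mul_sum, ← Finset.sum_add_distrib]
          refine Finset.sum_congr rfl fun i _ => Finset.sum_congr rfl fun a _ => ?_
          rw [pow_succ, mul_assoc ((F.shift i a : ℚ) ^ k), cast_mul_ringChoose]
          ring
      _ = 0 := by rw [h1, h2]; simp

lemma MinimalResolution.diagram_mem_diagramSpace {s : ℕ} (hs : ∀ i, s < i → F.rank i = 0)
    (hzero : ∀ k < s, F.altSum s k = 0) (m M : Fin (s + 1) → ℤ)
    (hm : ∀ (i : Fin (s + 1)) a, m i ≤ F.shift i a ∧ F.shift i a ≤ M i) :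
    F.diagram ∈ diagramSpace m M := by
  refine ⟨fun i hi j => ?_, fun i j hj => ?_, fun k hk => ?_⟩
  · by_contra h
    obtain ⟨a, -⟩ := (F.diagram_ne_zero_iff i j).1 h
    exact (Fin.cast (hs i hi) a).elim0
  · by_contra h
    obtain ⟨a, rfl⟩ := (F.diagram_ne_zero_iff i j).1 h
    have := hm i a
    omega
  · have h1 := F.windowSum_diagram m M (fun j => (j : ℚ) ^ k) hm
    have h2 := F.alternating_power_sum_eq_zero hzero k 0 (by omega)
    simp only [Ring.choose_zero_right, Int.cast_one, mul_one] at h2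
    rw [h2] at h1
    exact h1

lemma MinimalResolution.minShift_le (i : ℕ) {j : ℤ} (h : F.diagram i j ≠ 0) :
    minShift F.diagram i ≤ j :=
  csInf_le (F.finite_support_diagram i).bddBelow h

lemma MinimalResolution.le_maxShift (i : ℕ) {j : ℤ} (h : F.diagram i j ≠ 0) :
    j ≤ maxShift F.diagram i :=
  le_csSup (F.finite_support_diagram i).bddAbove h

lemma MinimalResolution.diagram_minShift_ne_zero (i : ℕ) {j : ℤ} (h : F.diagram i j ≠ 0) :
    F.diagram i (minShift F.diagram i) ≠ 0 :=
  Int.csInf_mem (s := {j | F.diagram i j ≠ 0}) ⟨j, h⟩ (F.finite_support_diagram i).bddBelow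

lemma MinimalResolution.diagram_maxShift_ne_zero (i : ℕ) {j : ℤ} (h : F.diagram i j ≠ 0) :
    F.diagram i (maxShift F.diagram i) ≠ 0 :=
  Int.csSup_mem (s := {j | F.diagram i j ≠ 0}) ⟨j, h⟩ (F.finite_support_diagram i).bddAbove

/-- If the normalized Betti diagram is a convex combination of pure diagrams, then the alternating
sums of binomial coefficients of the shifts satisfy the conjectured bounds. -/
lemma MinimalResolution.bound_le_altSum_le {s : ℕ} (m M : Fin (s + 1) → ℤ)
    (hm : ∀ (i : Fin (s + 1)) a, m i ≤ F.shift i a ∧ F.shift i a ≤ M i)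
    (h0 : ∀ a, F.shift 0 a = 0) (hrank : 0 < F.rank 0)
    (hconv : (fun i j => F.diagram i j / betaZero F.diagram) ∈ convexHull ℚ (pureDiagrams m M))
    (i : ℕ) :
    bound (betaZero F.diagram) i (fun j : Fin s => minShift F.diagram ((j : ℕ) + 1)) ≤
        (-1) ^ s * (F.altSum s (s + i) : ℚ) ∧
      (-1) ^ s * (F.altSum s (s + i) : ℚ) ≤
        bound (betaZero F.diagram) i (fun j : Fin s => maxShift F.diagram ((j : ℕ) + 1)) := by
  have hb : (0 : ℚ) < betaZero F.diagram := by
    rw [F.betaZero_diagram]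
    exact_mod_cast hrank
  obtain ⟨b, hbdef⟩ : ∃ b, b = betaZero F.diagram := ⟨_, rfl⟩
  rw [← hbdef] at hb hconv ⊢
  obtain ⟨ι, _, w, z, hw0, hw1, hz, hsum⟩ := mem_convexHull_iff_exists_fintype.1 hconv
  choose d hd hdz hdV using hz
  have hβ : F.diagram = b • ∑ t, w t • pureDiagram (d t) := by
    simp only [hdz, hsum]
    funext i j
    simp only [Pi.smul_apply, smul_eq_mul]
    field_simp
  have hβ' : ∀ (i : Fin (s + 1)) j, F.diagram i j = b * ∑ t, w t * pureDiagram (d t) i j := by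
    intro i j
    rw [hβ]
    simp
  have hdm : ∀ t i, m i ≤ d t i ∧ d t i ≤ M i := by
    intro t i
    by_contra h
    refine (pureDiagram_self_pos (d t) (hd t) i).ne' ?_
    rw [hdz]
    exact (hdV t).2.1 i _ (by omega)
  -- Pure diagrams have nonnegative entries, so nothing cancels, and the positions of every pure
  -- diagram of nonzero weight occur in the diagram of N.
  have hsupp : ∀ t, w t ≠ 0 → ∀ i : Fin (s + 1), F.diagram i (d t i) ≠ 0 := by
    intro t ht i
    have hpos : 0 < ∑ t', w t' * pureDiagram (d t') i (d t i) := by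
      refine Finset.sum_pos' (fun t' _ => mul_nonneg (hw0 t') ?_) ⟨t, Finset.mem_univ _,
        mul_pos (lt_of_le_of_ne (hw0 t) ht.symm) (pureDiagram_self_pos (d t) (hd t) i)⟩
      rw [pureDiagram_apply]
      split_ifs
      · exact (pureDiagram_self_pos (d t') (hd t') i).le
      · exact le_rfl
    rw [hβ']
    exact (mul_pos hb hpos).ne'
  have hattain : ∀ (i : Fin (s + 1)) j, F.diagram i j ≠ 0 → ∃ t, w t ≠ 0 ∧ d t i = j := by
    intro i j hj
    rw [hβ'] at hj
    obtain ⟨t, -, ht⟩ := Finset.exists_ne_zero_of_sum_ne_zero (right_ne_zero_of_mul hj)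
    refine ⟨t, left_ne_zero_of_mul ht, ?_⟩
    have := right_ne_zero_of_mul ht
    rw [pureDiagram_apply] at this
    by_contra hne
    exact this (if_neg fun h => hne h.symm)
  have hd0 : ∀ t, w t ≠ 0 → d t 0 = 0 := by
    intro t ht
    obtain ⟨a, ha⟩ := (F.diagram_ne_zero_iff 0 (d t 0)).1 (hsupp t ht 0)
    rw [← ha, h0]
  obtain ⟨t₀, ht₀⟩ : ∃ t, w t ≠ 0 := by
    by_contra! h
    simp [h] at hw1
  have hmin : ∀ i : Fin (s + 1), ∃ t, w t ≠ 0 ∧ d t i = minShift F.diagram i := fun i =>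
    hattain i _ (F.diagram_minShift_ne_zero i (hsupp t₀ ht₀ i))
  have hmax : ∀ i : Fin (s + 1), ∃ t, w t ≠ 0 ∧ d t i = maxShift F.diagram i := fun i =>
    hattain i _ (F.diagram_maxShift_ne_zero i (hsupp t₀ ht₀ i))
  -- Take a degree sequence attaining the minimum in row i'. Its entry in the earlier row i is
  -- strictly smaller, yet at least the minimum of that row.
  have hminMono : StrictMono fun i : Fin (s + 1) => minShift F.diagram i := by
    intro i i' hii
    obtain ⟨t, ht, hti⟩ := hmin i'
    calc minShift F.diagram i ≤ d t i := F.minShift_le i (hsupp t ht i)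
      _ < d t i' := hd t hii
      _ = _ := hti
  have hmaxMono : StrictMono fun i : Fin (s + 1) => maxShift F.diagram i := by
    intro i i' hii
    obtain ⟨t, ht, hti⟩ := hmax i
    calc maxShift F.diagram i = d t i := hti.symm
      _ < d t i' := hd t hii
      _ ≤ _ := F.le_maxShift i' (hsupp t ht i')
  have hsucc : ∀ t, w t ≠ 0 → ∀ j : Fin s, ((j : ℕ) : ℤ) + 1 ≤ d t j.succ := by
    intro t ht j
    have := natCast_le_of_strictMono (d t) (hd t) (hd0 t ht) j.succ
    simpa using this
  have hminMono' : StrictMono fun j : Fin s => minShift F.diagram ((j : ℕ) + 1) := by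
    intro j j' hjj
    have h := hminMono (Fin.succ_lt_succ_iff.2 hjj)
    simp only [Fin.val_succ] at h
    exact h
  have hmaxMono' : StrictMono fun j : Fin s => maxShift F.diagram ((j : ℕ) + 1) := by
    intro j j' hjj
    have h := hmaxMono (Fin.succ_lt_succ_iff.2 hjj)
    simp only [Fin.val_succ] at h
    exact h
  have hlow : ∀ t, w t ≠ 0 →
      bound 1 i (fun j : Fin s => minShift F.diagram ((j : ℕ) + 1)) ≤
        bound 1 i (fun j : Fin s => d t j.succ) := by
    intro t ht
    refine bound_mono 1 zero_le_one i _ _ hminMono'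
      (fun j j' hjj => hd t (Fin.succ_lt_succ_iff.2 hjj)) (fun j => ?_)
      fun j => F.minShift_le ((j : ℕ) + 1) (hsupp t ht j.succ)
    obtain ⟨t', ht', htj⟩ := hmin j.succ
    exact (hsucc t' ht' j).trans htj.le
  have hup : ∀ t, w t ≠ 0 →
      bound 1 i (fun j : Fin s => d t j.succ) ≤
        bound 1 i (fun j : Fin s => maxShift F.diagram ((j : ℕ) + 1)) := by
    intro t ht
    exact bound_mono 1 zero_le_one i _ _ (fun j j' hjj => hd t (Fin.succ_lt_succ_iff.2 hjj))
      hmaxMono' (hsucc t ht)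
      fun j => F.le_maxShift ((j : ℕ) + 1) (hsupp t ht j.succ)
  have hval : (-1) ^ s * (F.altSum s (s + i) : ℚ) =
      b * ∑ t, w t * bound 1 i (fun j : Fin s => d t j.succ) := by
    rw [F.cast_altSum, ← F.windowSum_diagram m M (fun j => ((Ring.choose j (s + i) : ℤ) : ℚ)) hm,
      hβ, windowSum_smul, windowSum_sum, mul_left_comm, Finset.mul_sum]
    congr 1
    refine Finset.sum_congr rfl fun t _ => ?_
    rw [windowSum_smul, windowSum_pureDiagram m M _ _ (hdm t), mul_left_comm]
    -- For weight 0 the sequence need not start at 0, so the evaluation of pure diagrams is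
    -- available only for nonzero weight.
    by_cases ht : w t = 0
    · simp [ht]
    · rw [sum_pureDiagram_mul_choose i (d t) (hd t) (hd0 t ht)]
  rw [hval, bound_eq_mul b, bound_eq_mul b]
  constructor
  · refine mul_le_mul_of_nonneg_left ?_ hb.le
    have h := Finset.sum_mul Finset.univ w
      (bound 1 i fun j : Fin s => minShift F.diagram ((j : ℕ) + 1))
    rw [hw1, one_mul] at h
    rw [h]
    refine Finset.sum_le_sum fun t _ => ?_
    by_cases ht : w t = 0
    · simp [ht]
    · exact mul_le_mul_of_nonneg_left (hlow t ht) (hw0 t)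
  · refine mul_le_mul_of_nonneg_left ?_ hb.le
    have h := Finset.sum_mul Finset.univ w
      (bound 1 i fun j : Fin s => maxShift F.diagram ((j : ℕ) + 1))
    rw [hw1, one_mul] at h
    rw [h]
    refine Finset.sum_le_sum fun t _ => ?_
    by_cases ht : w t = 0
    · simp [ht]
    · exact mul_le_mul_of_nonneg_left (hup t ht) (hw0 t)

end Diagrams

end BettiHilbert

end

/-! ### Proof of the proposition -/

theorem proposition2p3 {K : Type*} [Field K] (n s : ℕ) (hs : s ≤ n)
    (hBS : BettiHilbert.BoijSoderbergConjecture K n s) :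
    BettiHilbert.HilbertCoefficientConjecture K n s := by
  intro N _ _ _ _ 𝒩 F hfin hCM hcodim hgen
  have hrank := F.rank_eq_zero hCM hcodim
  have : Nontrivial N := by
    rw [← Module.supportDim_ne_bot_iff_nontrivial (MvPolynomial (Fin n) K)]
    intro h
    rw [BettiHilbert.HasCodim, h, WithBot.bot_add] at hcodim
    exact WithBot.bot_ne_coe hcodim
  have hzero : ∀ k < s, F.altSum s k = 0 :=
    F.altSum_eq_zero s hrank hs (F.tendsto_hilbertFunction_div_of_hasCodim hcodim)
  have hcoeff := F.isHilbertCoefficients s hrank hs hzero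
  refine ⟨⟨_, hcoeff, fun e he => BettiHilbert.Grading.isHilbertCoefficients_unique he hcoeff⟩,
    fun e he i => ?_⟩
  rw [BettiHilbert.Grading.isHilbertCoefficients_unique he hcoeff]
  -- The minimal and maximal shifts are not yet known to increase strictly, so the conjecture is
  -- applied to a crude window containing all shifts. The sharp bounds are recovered afterwards from
  -- the supports of the pure diagrams.
  obtain ⟨B, hB⟩ : ∃ B : ℕ, ∀ i : Fin (s + 1), ∀ a, (F.shift i a).natAbs ≤ B := by
    refine ⟨Finset.univ.sup fun i : Fin (s + 1) => Finset.univ.sup fun a => (F.shift i a).natAbs,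
      fun i a => ?_⟩
    exact (Finset.le_sup (f := fun a => (F.shift i a).natAbs) (Finset.mem_univ a)).trans
      (Finset.le_sup (f := fun i : Fin (s + 1) => Finset.univ.sup fun a => (F.shift i a).natAbs)
        (Finset.mem_univ i))
  -- The summand i makes the window strictly increasing; subtracting s keeps m_i ≤ -B, as i ≤ s.
  let m : Fin (s + 1) → ℤ := fun i => -(B + s) + (i : ℕ)
  let M : Fin (s + 1) → ℤ := fun i => B + (i : ℕ)
  have hm : ∀ (i : Fin (s + 1)) a, m i ≤ F.shift i a ∧ F.shift i a ≤ M i := by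
    intro i a
    have h1 := hB i a
    have h2 := i.2
    simp only [m, M]
    omega
  have hrank0 : 0 < F.rank 0 := by
    rw [Nat.pos_iff_ne_zero]
    intro h
    have : IsEmpty (Fin (F.rank 0)) := by
      rw [h]
      infer_instance
    exact not_subsingleton N F.aug_surjective.subsingleton
  have hconv : (fun i j => F.diagram i j / BettiHilbert.betaZero F.diagram) ∈
      convexHull ℚ (BettiHilbert.pureDiagrams m M) := by
    rw [← hBS m M (fun i j hij => by simpa [m] using hij) (fun i j hij => by simpa [M] using hij)]
    exact ⟨F.diagram, ⟨F.diagram_mem_diagramSpace hrank hzero m M hm,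
      N, _, _, _, ‹_›, 𝒩, F, hfin, hCM, hcodim, rfl⟩, rfl⟩
  have := F.bound_le_altSum_le m M hm (F.shift_zero_eq_zero hgen) hrank0 hconv i
  push_cast
  exact this
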